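/- Let $N$ be a $\mathrm{II}_1$ factor, i.e. an infinite-dimensional von Neumann algebra with trivial center that carries a faithful normal tracial state $\tau$, and put $\|x\|_2=\tau(x^*x)^{1/2}$ for $x\in N$. Let $\sigma:\Gamma\curvearrowright N$ be an action of a discrete group $\Gamma$ by $*$-automorphisms. Suppose that for every (operator-norm) bounded net $(x_i)_{i\in I}$ in $N$ which satisfies $\lim_i\|x_ia-ax_i\|_2=0$ for all $a\in N$ and $\lim_i\|\sigma_g(x_i)-x_i\|_2=0$ for all $g\in\Gamma$, we have $\lim_i\|x_i-\tau(x_i)1\|_2=0$. Then there exist a finite set $S\subset\mathcal U(N)$ of unitaries of $N$, a finite set $K\subset\Gamma$ and a constant $\kappa>0$ such that for all $x\in N$ \[ \|x-\tau(x)1\|_2\le\kappa\Big(\sum_{u\in S}\|ux-xu\|_2+\sum_{g\in K}\|\sigma_g(x)-x\|_2\Big). \] -/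

import Mathlib

universe u v

open Filter Topology
open scoped ComplexOrder

/-- The von Neumann algebra `N` on the Hilbert space `H` is a factor: its center consists of the
scalar multiples of the identity. -/
def VonNeumannAlgebra.IsFactor {H : Type*} [NormedAddCommGroup H] [InnerProductSpace ℂ H]
    [CompleteSpace H] (N : VonNeumannAlgebra H) : Prop :=
  ∀ z : N.toStarSubalgebra, (∀ a : N.toStarSubalgebra, a * z = z * a) → ∃ c : ℂ, z = c • 1

/-- `τ` is a faithful normal tracial state on the von Neumann algebra `N`. Here `N` carries the
Loewner order inherited from the bounded operators on `H`, and normality means that `τ` preserves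
suprema of (bounded) upward directed families of positive elements of `N`. -/
structure IsFaithfulNormalTracialState {H : Type*} [NormedAddCommGroup H]
    [InnerProductSpace ℂ H] [CompleteSpace H] (N : VonNeumannAlgebra H)
    (τ : N.toStarSubalgebra →ₗ[ℂ] ℂ) : Prop where
  map_one : τ 1 = 1
  nonneg : ∀ x, 0 ≤ τ (star x * x)
  tracial : ∀ x y, τ (x * y) = τ (y * x)
  faithful : ∀ x, τ (star x * x) = 0 → x = 0
  normal : ∀ (D : Set N.toStarSubalgebra) (a : N.toStarSubalgebra), D.Nonempty →
    DirectedOn (· ≤ ·) D → (∀ d ∈ D, 0 ≤ d) → IsLUB D a →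
    IsLUB ((fun d => (τ d).re) '' D) (τ a).re

/-- `N` is a II₁ factor and `τ` is its trace: `N` is an infinite-dimensional factor and `τ` is a
faithful normal tracial state on it. -/
structure IsIIOneFactor {H : Type*} [NormedAddCommGroup H]
    [InnerProductSpace ℂ H] [CompleteSpace H] (N : VonNeumannAlgebra H)
    (τ : N.toStarSubalgebra →ₗ[ℂ] ℂ) : Prop where
  factor : N.IsFactor
  infinite_dimensional : ¬ FiniteDimensional ℂ N.toStarSubalgebra
  trace : IsFaithfulNormalTracialState N τ

/-- The 2-norm `‖x‖₂ = τ(x* x)^{1/2}` of a state `τ`. -/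
noncomputable def twoNorm {H : Type*} [NormedAddCommGroup H]
    [InnerProductSpace ℂ H] [CompleteSpace H] {N : VonNeumannAlgebra H}
    (τ : N.toStarSubalgebra →ₗ[ℂ] ℂ) (x : N.toStarSubalgebra) : ℝ :=
  Real.sqrt (τ (star x * x)).re

set_option linter.unusedSectionVars false

/-! Adjoin all inner automorphisms to σ. Unitaries span N, so the hypothesis on nets takes a uniform
form: elements of a fixed operator-norm ball that are almost fixed by suitable finitely many of
these automorphisms are almost scalar (`almostFixedAreScalar_withInner`). The difficulty is that the
conclusion concerns elements controlled only in 2-norm.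

If the gap fails, there are self-adjoint x with τ(x) = 0 and ‖x‖₂ = 1, almost fixed by any
prescribed finite family. Clipping is contractive for ‖·‖₂, so the clipped x is bounded and almost
fixed, hence almost scalar, hence almost 0 because τ(x) = 0. So the mass of x sits at large heights,
over a set of small trace. An averaging argument over geometrically growing heights
(`exists_cutoff`) selects a cutoff y = φ(x) with 0 ≤ y ≤ 1 that is almost a projection, has
arbitrarily small ‖y‖₂, and is displaced little relative to ‖y‖₂.

Such small pieces are patched together (`exists_almostInvariant`). Zorn's lemma gives a maximal q
among the almost invariant almost projections of trace at most 1/4. If τ(q) < 1/8, then q + (1 -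
q)^{1/2} y² (1 - q)^{1/2} is a strictly larger one; comparison of projections in the factor prevents
q from absorbing an almost central y. Hence 1/8 ≤ τ(q) ≤ 1/4, whereas q is bounded and almost fixed,
so almost scalar: impossible for an almost projection of such trace.

Functions of x are compared with functions of its image under an automorphism through
`re_sum_cfc_mul_cfc_nonneg`, which transfers pointwise inequalities on ℝ² to traces of two
noncommuting elements. The von Neumann algebra input is suprema as weak operator limits and
comparison by way of extreme points and primeness of factors. -/

/-- `τ` is a faithful tracial state on a C⋆-algebra. -/
structure IsFaithfulTracialState {A : Type*} [CStarAlgebra A] (τ : A →ₗ[ℂ] ℂ) : Prop where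
  map_one : τ 1 = 1
  nonneg : ∀ x, 0 ≤ τ (star x * x)
  tracial : ∀ x y, τ (x * y) = τ (y * x)
  faithful : ∀ x, τ (star x * x) = 0 → x = 0

/-- The norm `‖x‖₂ = τ(x* x)^{1/2}` attached to a linear functional on a C⋆-algebra. -/
noncomputable def l2Norm {A : Type*} [CStarAlgebra A] (τ : A →ₗ[ℂ] ℂ) (x : A) : ℝ :=
  Real.sqrt (τ (star x * x)).re

/-! ### The 2-norm of a faithful tracial state -/

namespace IsFaithfulTracialState

variable {A : Type*} [CStarAlgebra A] [PartialOrder A] [StarOrderedRing A] {τ : A →ₗ[ℂ] ℂ}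

lemma map_nonneg (h : IsFaithfulTracialState τ) {x : A} (hx : 0 ≤ x) : 0 ≤ τ x := by
  obtain ⟨y, rfl⟩ := CStarAlgebra.nonneg_iff_eq_star_mul_self.mp hx
  exact h.nonneg y

lemma re_nonneg (h : IsFaithfulTracialState τ) {x : A} (hx : 0 ≤ x) : 0 ≤ (τ x).re :=
  (Complex.nonneg_iff.mp (h.map_nonneg hx)).1

lemma re_mono (h : IsFaithfulTracialState τ) {x y : A} (hxy : x ≤ y) : (τ x).re ≤ (τ y).re := by
  have := h.re_nonneg (sub_nonneg.mpr hxy)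
  simpa using this

lemma re_star (h : IsFaithfulTracialState τ) (x : A) : τ (star x) = star (τ x) := by
  let f : A →ₚ[ℂ] ℂ := PositiveLinearMap.mk₀ τ fun x hx => h.map_nonneg hx
  exact map_star f x

/-- Writing y = c*c, cyclicity turns the trace of xy into that of c x c*. No commutation is needed.
-/
lemma re_mul_nonneg (h : IsFaithfulTracialState τ) {x y : A} (hx : 0 ≤ x) (hy : 0 ≤ y) :
    0 ≤ (τ (x * y)).re := by
  obtain ⟨c, rfl⟩ := CStarAlgebra.nonneg_iff_eq_star_mul_self.mp hy
  rw [← mul_assoc, h.tracial, ← mul_assoc]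
  exact h.re_nonneg (star_right_conjugate_nonneg hx c)

lemma re_mul_mono (h : IsFaithfulTracialState τ) {x y z : A} (hx : 0 ≤ x) (hyz : y ≤ z) :
    (τ (x * y)).re ≤ (τ (x * z)).re := by
  have := h.re_mul_nonneg hx (sub_nonneg.mpr hyz)
  simpa [mul_sub] using this

lemma eq_zero_of_re (h : IsFaithfulTracialState τ) {x : A} (hx : 0 ≤ x) (h0 : (τ x).re ≤ 0) :
    x = 0 := by
  obtain ⟨c, rfl⟩ := CStarAlgebra.nonneg_iff_eq_star_mul_self.mp hx
  have h1 := Complex.nonneg_iff.mp (h.nonneg c)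
  have : c = 0 := h.faithful c (Complex.ext (le_antisymm h0 h1.1) h1.2.symm)
  simp [this]

lemma l2Norm_nonneg (x : A) : 0 ≤ l2Norm τ x := Real.sqrt_nonneg _

lemma l2Norm_sq (h : IsFaithfulTracialState τ) (x : A) :
    l2Norm τ x ^ 2 = (τ (star x * x)).re :=
  Real.sq_sqrt (h.re_nonneg (star_mul_self_nonneg x))

lemma l2Norm_sq_of_isSelfAdjoint (h : IsFaithfulTracialState τ) {x : A} (hx : IsSelfAdjoint x) :
    l2Norm τ x ^ 2 = (τ (x * x)).re := by
  rw [h.l2Norm_sq, hx.star_eq]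

/-- `l2Norm` is definitionally the GNS norm, so the triangle inequality is inherited; homogeneity,
Cauchy–Schwarz and the bound for left multiplication are obtained in the same way. -/
lemma l2Norm_add_le (h : IsFaithfulTracialState τ) (x y : A) :
    l2Norm τ (x + y) ≤ l2Norm τ x + l2Norm τ y := by
  let f : A →ₚ[ℂ] ℂ := PositiveLinearMap.mk₀ τ fun x hx => h.map_nonneg hx
  exact norm_add_le (f.toPreGNS x) (f.toPreGNS y)

lemma l2Norm_smul (h : IsFaithfulTracialState τ) (c : ℂ) (x : A) :
    l2Norm τ (c • x) = ‖c‖ * l2Norm τ x := by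
  let f : A →ₚ[ℂ] ℂ := PositiveLinearMap.mk₀ τ fun x hx => h.map_nonneg hx
  exact norm_smul c (f.toPreGNS x)

lemma l2Norm_neg (x : A) : l2Norm τ (-x) = l2Norm τ x := by
  simp [l2Norm]

lemma l2Norm_sub_comm (x y : A) : l2Norm τ (x - y) = l2Norm τ (y - x) := by
  rw [← neg_sub, l2Norm_neg]

lemma l2Norm_zero : l2Norm τ (0 : A) = 0 := by simp [l2Norm]

lemma l2Norm_sub_le (h : IsFaithfulTracialState τ) (x y : A) :
    l2Norm τ (x - y) ≤ l2Norm τ x + l2Norm τ y := by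
  rw [sub_eq_add_neg, ← l2Norm_neg y]; exact h.l2Norm_add_le _ _

lemma norm_map_star_mul_le (h : IsFaithfulTracialState τ) (x y : A) :
    ‖τ (star x * y)‖ ≤ l2Norm τ x * l2Norm τ y := by
  let f : A →ₚ[ℂ] ℂ := PositiveLinearMap.mk₀ τ fun x hx => h.map_nonneg hx
  exact norm_inner_le_norm (𝕜 := ℂ) (f.toPreGNS x) (f.toPreGNS y)

lemma l2Norm_star (h : IsFaithfulTracialState τ) (x : A) : l2Norm τ (star x) = l2Norm τ x := by
  rw [l2Norm, l2Norm, star_star, h.tracial]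

lemma abs_re_mul_le (h : IsFaithfulTracialState τ) (x y : A) :
    |(τ (x * y)).re| ≤ l2Norm τ x * l2Norm τ y := by
  have := h.norm_map_star_mul_le (star x) y
  rw [star_star, h.l2Norm_star] at this
  exact (Complex.abs_re_le_norm _).trans this

lemma l2Norm_mul_le (h : IsFaithfulTracialState τ) (a x : A) :
    l2Norm τ (a * x) ≤ ‖a‖ * l2Norm τ x := by
  let f : A →ₚ[ℂ] ℂ := PositiveLinearMap.mk₀ τ fun x hx => h.map_nonneg hx
  refine ((f.leftMulMapPreGNS a).le_opNorm (f.toPreGNS x)).trans ?_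
  refine mul_le_mul_of_nonneg_right ?_ (l2Norm_nonneg x)
  exact LinearMap.mkContinuous_norm_le _ (norm_nonneg a) _

lemma l2Norm_mul_le' (h : IsFaithfulTracialState τ) (x a : A) :
    l2Norm τ (x * a) ≤ l2Norm τ x * ‖a‖ := by
  rw [← h.l2Norm_star, star_mul, mul_comm, ← h.l2Norm_star x, ← norm_star a]
  exact h.l2Norm_mul_le _ _

lemma l2Norm_mul_le_of_norm_le_one (h : IsFaithfulTracialState τ) {a : A} (ha : ‖a‖ ≤ 1) (x : A) :
    l2Norm τ (a * x) ≤ l2Norm τ x :=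
  (h.l2Norm_mul_le a x).trans (mul_le_of_le_one_left (l2Norm_nonneg x) ha)

lemma l2Norm_mul_le_of_norm_le_one' (h : IsFaithfulTracialState τ) {a : A} (ha : ‖a‖ ≤ 1) (x : A) :
    l2Norm τ (x * a) ≤ l2Norm τ x :=
  (h.l2Norm_mul_le' x a).trans (mul_le_of_le_one_right (l2Norm_nonneg x) ha)

lemma l2Norm_one (h : IsFaithfulTracialState τ) : l2Norm τ (1 : A) = 1 := by
  simp [l2Norm, h.map_one]

lemma l2Norm_le_norm (h : IsFaithfulTracialState τ) (x : A) : l2Norm τ x ≤ ‖x‖ := by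
  simpa [h.l2Norm_one] using h.l2Norm_mul_le x 1

lemma norm_map_le (h : IsFaithfulTracialState τ) (x : A) : ‖τ x‖ ≤ l2Norm τ x := by
  simpa [h.l2Norm_one] using h.norm_map_star_mul_le 1 x

lemma continuous (h : IsFaithfulTracialState τ) : Continuous τ :=
  AddMonoidHomClass.continuous_of_bound τ 1 fun x => by
    simpa using (h.norm_map_le x).trans (h.l2Norm_le_norm x)

lemma nontrivial (h : IsFaithfulTracialState τ) : Nontrivial A :=
  ⟨0, 1, fun h01 => by simpa [← h01] using h.map_one⟩

lemma norm_unitary_le (h : IsFaithfulTracialState τ) (u : unitary A) : ‖(u : A)‖ ≤ 1 := by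
  have := h.nontrivial
  exact (CStarRing.norm_coe_unitary u).le

/-- The two elements differ by a unitary factor on the right. Commutators with unitaries thus become
displacements under inner automorphisms. -/
lemma l2Norm_unitary_conj_sub (h : IsFaithfulTracialState τ) (u : unitary A) (x : A) :
    l2Norm τ ((u : A) * x * star (u : A) - x) = l2Norm τ ((u : A) * x - x * u) := by
  have hu : ‖(u : A)‖ ≤ 1 := h.norm_unitary_le u
  have hu' : ‖star (u : A)‖ ≤ 1 := by rwa [norm_star]
  have e1 : (u : A) * x * star (u : A) - x = ((u : A) * x - x * u) * star (u : A) := by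
    rw [sub_mul, mul_assoc x, Unitary.mul_star_self_of_mem u.2, mul_one]
  have e2 : (u : A) * x - x * u = ((u : A) * x * star (u : A) - x) * u := by
    rw [sub_mul, mul_assoc _ (star (u : A)), Unitary.star_mul_self_of_mem u.2, mul_one]
  refine le_antisymm ?_ ?_
  · rw [e1]; exact h.l2Norm_mul_le_of_norm_le_one' hu' _
  · rw [e2]; exact h.l2Norm_mul_le_of_norm_le_one' hu _

/-- `‖x‖₂² ≤ τ(x)` for `0 ≤ x ≤ 1`. -/
lemma l2Norm_sq_le_re (h : IsFaithfulTracialState τ) {x : A} (h0 : 0 ≤ x) (h1 : x ≤ 1) :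
    l2Norm τ x ^ 2 ≤ (τ x).re := by
  rw [h.l2Norm_sq_of_isSelfAdjoint (IsSelfAdjoint.of_nonneg h0)]
  simpa using h.re_mul_mono h0 h1

end IsFaithfulTracialState

/-! ### Partitions of unity and trace inequalities in two noncommuting variables -/

/-- The piecewise linear bump function with support `[j, j + 2]`. -/
noncomputable def bump (j : ℤ) (s : ℝ) : ℝ :=
  max 0 (min 1 (s - j)) - max 0 (min 1 (s - (j + 1 : ℤ)))

lemma continuous_bump (j : ℤ) : Continuous (bump j) := by
  unfold bump; fun_prop

lemma bump_nonneg (j : ℤ) (s : ℝ) : 0 ≤ bump j s := by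
  unfold bump; push_cast
  exact sub_nonneg.mpr (max_le_max le_rfl (min_le_min le_rfl (by linarith)))

lemma abs_sub_le_of_bump_ne_zero {j : ℤ} {s : ℝ} (h : bump j s ≠ 0) : |s - j| ≤ 2 := by
  by_contra hc
  apply h
  unfold bump; push_cast
  rw [not_le, lt_abs] at hc
  rcases hc with hc | hc
  · rw [min_eq_left (by linarith), min_eq_left (by linarith), sub_self]
  · rw [min_eq_right (by linarith), min_eq_right (by linarith), max_eq_left (by linarith),
      max_eq_left (by linarith), sub_self]

/-- The sum telescopes to the clamped ramp starting at -m minus the one starting at m; the margin 1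
in the hypothesis makes these 1 and 0. -/
lemma sum_bump (m : ℕ) {s : ℝ} (hs : |s| + 1 ≤ m) :
    ∑ j ∈ Finset.range (2 * m), bump ((j : ℤ) - m) s = 1 := by
  have key := Finset.sum_range_sub' (fun j : ℕ => max 0 (min 1 (s - ((j : ℤ) - m : ℤ)))) (2 * m)
  have h1 := abs_le.mp (le_of_eq (rfl : |s| = |s|))
  calc _ = _ := Finset.sum_congr rfl fun j _ => by
        unfold bump
        rw [show ((j : ℤ) - m + 1 : ℤ) = ((j + 1 : ℕ) : ℤ) - m by push_cast; ring]
    _ = _ := key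
    _ = 1 := by
      push_cast
      rw [min_eq_left (by linarith), min_eq_right (by linarith), max_eq_right (by norm_num),
        max_eq_left (by linarith), sub_zero]

/-- Piecewise linear approximation of `f` with mesh `1 / n`. -/
noncomputable def bumpApprox (R n : ℕ) (f : ℝ → ℝ) (s : ℝ) : ℝ :=
  ∑ j ∈ Finset.range (2 * (n * R + 1)),
    f ((((j : ℤ) - (n * R + 1 : ℕ) : ℤ) : ℝ) / n) * bump ((j : ℤ) - (n * R + 1 : ℕ)) (n * s)

lemma tendstoUniformlyOn_bumpApprox (R : ℕ) {f : ℝ → ℝ} (hf : Continuous f) :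
    TendstoUniformlyOn (fun n => bumpApprox R n f) f atTop (Set.Icc (-R) R) := by
  -- The nodes whose bump is nonzero at s lie within 2/n ≤ 2 of s, possibly outside [-R, R]; hence
  -- the enlarged interval.
  have huc : UniformContinuousOn f (Set.Icc (-R - 2) (R + 2)) :=
    isCompact_Icc.uniformContinuousOn_of_continuous hf.continuousOn
  rw [Metric.tendstoUniformlyOn_iff]
  intro ε hε
  obtain ⟨δ, hδ, H⟩ := Metric.uniformContinuousOn_iff.mp huc (ε / 2) (half_pos hε)
  obtain ⟨n₀, hn₀⟩ := exists_nat_gt (2 / δ)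
  filter_upwards [eventually_ge_atTop (max n₀ 1)] with n hn s hs
  have hn1 : (1 : ℝ) ≤ n := by exact_mod_cast (le_max_right _ _).trans hn
  have hn0 : (0 : ℝ) < n := by linarith
  have hnn : (n₀ : ℝ) ≤ n := by exact_mod_cast (le_max_left _ _).trans hn
  have h2n : 2 / (n : ℝ) < δ := by
    rw [div_lt_iff₀ hn0]; rw [div_lt_iff₀ hδ] at hn₀; nlinarith
  have h2n' : 2 / (n : ℝ) ≤ 2 := by rw [div_le_iff₀ hn0]; linarith
  have hsum : ∑ j ∈ Finset.range (2 * (n * R + 1)),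
      bump ((j : ℤ) - (n * R + 1 : ℕ)) (n * s) = 1 := by
    refine sum_bump _ ?_
    push_cast
    rw [abs_mul, abs_of_pos hn0]
    have := abs_le.mpr hs
    nlinarith
  rw [dist_eq_norm, Real.norm_eq_abs]
  have : f s - bumpApprox R n f s = ∑ j ∈ Finset.range (2 * (n * R + 1)),
      (f s - f ((((j : ℤ) - (n * R + 1 : ℕ) : ℤ) : ℝ) / n)) *
        bump ((j : ℤ) - (n * R + 1 : ℕ)) (n * s) := by
    simp only [sub_mul, Finset.sum_sub_distrib, ← Finset.mul_sum, hsum, mul_one, bumpApprox]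
  rw [this]
  refine lt_of_le_of_lt (b := ε / 2) ?_ (half_lt_self hε)
  refine (Finset.abs_sum_le_sum_abs _ _).trans ?_
  calc _ ≤ ∑ j ∈ Finset.range (2 * (n * R + 1)),
        ε / 2 * bump ((j : ℤ) - (n * R + 1 : ℕ)) (n * s) := by
        refine Finset.sum_le_sum fun j _ => ?_
        generalize (j : ℤ) - (n * R + 1 : ℕ) = i
        rw [abs_mul, abs_of_nonneg (bump_nonneg _ _)]
        by_cases h0 : bump i (n * s) = 0
        · simp [h0]
        refine mul_le_mul_of_nonneg_right ?_ (bump_nonneg _ _)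
        have h1 : |s - i / n| ≤ 2 / n := by
          have e : s - i / n = (n * s - i) / n := by field_simp
          rw [e, abs_div, abs_of_pos hn0]
          gcongr
          exact abs_sub_le_of_bump_ne_zero h0
        have h2 := abs_le.mp (h1.trans h2n')
        have := H s ⟨by linarith [hs.1], by linarith [hs.2]⟩ (i / n)
          ⟨by linarith [hs.1], by linarith [hs.2]⟩ (by
            rw [dist_eq_norm, Real.norm_eq_abs]; exact lt_of_le_of_lt h1 h2n)
        rw [dist_eq_norm, Real.norm_eq_abs] at this
        exact this.le
    _ = ε / 2 := by rw [← Finset.mul_sum, hsum, mul_one]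

lemma continuous_bumpApprox (R n : ℕ) (f : ℝ → ℝ) : Continuous (bumpApprox R n f) := by
  unfold bumpApprox
  refine continuous_finsetSum _ fun j _ => ?_
  exact continuous_const.mul ((continuous_bump _).comp (by fun_prop))

namespace IsFaithfulTracialState

variable {A : Type*} [CStarAlgebra A] [PartialOrder A] [StarOrderedRing A] {τ : A →ₗ[ℂ] ℂ}

lemma cfc_bumpApprox (R n : ℕ) (f : ℝ → ℝ) (a : A) :
    cfc (bumpApprox R n f) a = ∑ j ∈ Finset.range (2 * (n * R + 1)),
      (f ((((j : ℤ) - (n * R + 1 : ℕ) : ℤ) : ℝ) / n)) •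
        cfc (fun s => bump ((j : ℤ) - (n * R + 1 : ℕ)) (n * s)) a := by
  have hc : ∀ j : ℤ, Continuous fun s : ℝ => bump j (n * s) := fun j =>
    (continuous_bump _).comp (by fun_prop)
  have : bumpApprox R n f = ∑ j ∈ Finset.range (2 * (n * R + 1)), fun s =>
      f ((((j : ℤ) - (n * R + 1 : ℕ) : ℤ) : ℝ) / n) *
        bump ((j : ℤ) - (n * R + 1 : ℕ)) (n * s) := by
    ext s; simp [bumpApprox]
  rw [this, cfc_sum _ a _ (fun j _ => Continuous.continuousOn (by have := hc; fun_prop))]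
  refine Finset.sum_congr rfl fun j _ => ?_
  exact cfc_const_mul _ _ a (hc _).continuousOn

/-- If `∑ fᵢ(s) gᵢ(t) ≥ 0` on `ℝ²` then `∑ τ(fᵢ(a) gᵢ(b)) ≥ 0` for self-adjoint `a` and `b`. -/
theorem re_sum_cfc_mul_cfc_nonneg (h : IsFaithfulTracialState τ) {ι : Type*} (I : Finset ι)
    {f g : ι → ℝ → ℝ} (hf : ∀ i, Continuous (f i)) (hg : ∀ i, Continuous (g i))
    (hfg : ∀ s t, 0 ≤ ∑ i ∈ I, f i s * g i t) {a b : A} (ha : IsSelfAdjoint a)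
    (hb : IsSelfAdjoint b) : 0 ≤ ∑ i ∈ I, (τ (cfc (f i) a * cfc (g i) b)).re := by
  obtain ⟨R, hR⟩ := exists_nat_ge (max ‖a‖ ‖b‖)
  have := h.nontrivial
  have hspec : ∀ {x : A}, IsSelfAdjoint x → ‖x‖ ≤ R → spectrum ℝ x ⊆ Set.Icc (-R : ℝ) R := by
    intro x _ hx s hs
    have := spectrum.norm_le_norm_of_mem hs
    exact abs_le.mp (this.trans hx)
  have hlim : ∀ {x : A}, IsSelfAdjoint x → ‖x‖ ≤ R → ∀ {φ : ℝ → ℝ}, Continuous φ →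
      Tendsto (fun n => cfc (bumpApprox R n φ) x) atTop (𝓝 (cfc φ x)) := by
    intro x hx hxR φ hφ
    refine tendsto_cfc_fun ((tendstoUniformlyOn_bumpApprox R hφ).mono (hspec hx hxR)) ?_
    exact Eventually.of_forall fun n => (continuous_bumpApprox R n φ).continuousOn
  have hT : Tendsto (fun n => ∑ i ∈ I, (τ (cfc (bumpApprox R n (f i)) a *
      cfc (bumpApprox R n (g i)) b)).re) atTop
      (𝓝 (∑ i ∈ I, (τ (cfc (f i) a * cfc (g i) b)).re)) := by
    refine tendsto_finsetSum _ fun i _ => ?_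
    refine (Complex.continuous_re.tendsto _).comp ((h.continuous.tendsto _).comp ?_)
    exact (hlim ha ((le_max_left _ _).trans hR) (hf i)).mul
      (hlim hb ((le_max_right _ _).trans hR) (hg i))
  -- For the approximants the trace expands over pairs of nodes: the coefficient is the sum of f i ·
  -- g i at a point of ℝ², nonnegative by `hfg`, and it multiplies the trace of a product of two
  -- positive elements.
  refine ge_of_tendsto' hT fun n => ?_
  have hc : ∀ j : ℤ, Continuous fun s : ℝ => bump j (n * s) := fun j =>
    (continuous_bump _).comp (by fun_prop)
  have : ∀ i, (τ (cfc (bumpApprox R n (f i)) a * cfc (bumpApprox R n (g i)) b)).re =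
      ∑ j ∈ Finset.range (2 * (n * R + 1)), ∑ k ∈ Finset.range (2 * (n * R + 1)),
        (f i ((((j : ℤ) - (n * R + 1 : ℕ) : ℤ) : ℝ) / n) *
          g i ((((k : ℤ) - (n * R + 1 : ℕ) : ℤ) : ℝ) / n)) *
        (τ (cfc (fun s => bump ((j : ℤ) - (n * R + 1 : ℕ)) (n * s)) a *
          cfc (fun s => bump ((k : ℤ) - (n * R + 1 : ℕ)) (n * s)) b)).re := by
    intro i
    rw [cfc_bumpApprox R n _ a, cfc_bumpApprox R n _ b, Finset.sum_mul_sum, map_sum,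
      Complex.re_sum]
    refine Finset.sum_congr rfl fun j _ => ?_
    rw [map_sum, Complex.re_sum]
    refine Finset.sum_congr rfl fun k _ => ?_
    rw [smul_mul_smul_comm, ← Complex.coe_smul, map_smul, smul_eq_mul, Complex.re_ofReal_mul]
  rw [Finset.sum_congr rfl fun i _ => this i, Finset.sum_comm]
  refine Finset.sum_nonneg fun j _ => ?_
  rw [Finset.sum_comm]
  refine Finset.sum_nonneg fun k _ => ?_
  rw [← Finset.sum_mul]
  refine mul_nonneg (hfg _ _) (h.re_mul_nonneg ?_ ?_)
  · exact cfc_nonneg fun s _ => bump_nonneg _ _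
  · exact cfc_nonneg fun s _ => bump_nonneg _ _

/-- An inequality between weighted squared increments of real functions yields the
corresponding inequality for the `2`-norms of the increments of the functional calculus. -/
theorem sum_mul_l2Norm_cfc_sub_sq_nonneg (h : IsFaithfulTracialState τ) {ι : Type*} (I : Finset ι)
    (c : ι → ℝ) {f : ι → ℝ → ℝ} (hf : ∀ i, Continuous (f i))
    (hfs : ∀ s t, 0 ≤ ∑ i ∈ I, c i * (f i s - f i t) ^ 2) {a b : A} (ha : IsSelfAdjoint a)
    (hb : IsSelfAdjoint b) :
    0 ≤ ∑ i ∈ I, c i * l2Norm τ (cfc (f i) a - cfc (f i) b) ^ 2 := by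
  -- The three indices encode (f s - f t)² = f(s)²·1 - 2f(s)·f(t) + 1·f(t)², a sum of products of a
  -- function of s and a function of t.
  let F : ι × Fin 3 → ℝ → ℝ := fun p s => ![f p.1 s * f p.1 s, -2 * f p.1 s, 1] p.2
  let G : ι × Fin 3 → ℝ → ℝ := fun p s => ![1, f p.1 s, f p.1 s * f p.1 s] p.2
  have hF : ∀ p, Continuous (F p) := by
    rintro ⟨i, k⟩
    have := hf i
    fin_cases k <;> simp only [F] <;> simp <;> fun_prop
  have hG : ∀ p, Continuous (G p) := by
    rintro ⟨i, k⟩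
    have := hf i
    fin_cases k <;> simp only [G] <;> simp <;> fun_prop
  have hexp : ∀ i, c i * l2Norm τ (cfc (f i) a - cfc (f i) b) ^ 2 =
      ∑ k : Fin 3, (τ (cfc (fun s => c i * F (i, k) s) a * cfc (G (i, k)) b)).re := by
    intro i
    have hφ := hf i
    have hc : ∀ k, (τ (cfc (fun s => c i * F (i, k) s) a * cfc (G (i, k)) b)).re =
        c i * (τ (cfc (F (i, k)) a * cfc (G (i, k)) b)).re := fun k => by
      rw [cfc_const_mul _ _ a (hF _).continuousOn, smul_mul_assoc, ← Complex.coe_smul, map_smul,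
        smul_eq_mul, Complex.re_ofReal_mul]
    simp only [hc, ← Finset.mul_sum]
    congr 1
    simp only [Fin.sum_univ_three, F, G, Matrix.cons_val]
    rw [h.l2Norm_sq_of_isSelfAdjoint ((cfc_predicate (f i) a).sub (cfc_predicate (f i) b)),
      cfc_mul (f i) (f i) a hφ.continuousOn hφ.continuousOn,
      cfc_mul (f i) (f i) b hφ.continuousOn hφ.continuousOn,
      cfc_const_mul (-2) (f i) a hφ.continuousOn, cfc_const_one ℝ a, cfc_const_one ℝ b]
    have ht := h.tracial (cfc (f i) b) (cfc (f i) a)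
    simp only [sub_mul, mul_sub, map_sub, ht, mul_one, one_mul, Complex.sub_re, smul_mul_assoc]
    rw [← Complex.coe_smul, map_smul, smul_eq_mul, Complex.re_ofReal_mul]
    ring
  rw [Finset.sum_congr rfl fun i _ => hexp i, ← Finset.sum_product']
  refine h.re_sum_cfc_mul_cfc_nonneg (I ×ˢ (Finset.univ : Finset (Fin 3)))
    (f := fun p s => c p.1 * F p s) (fun p => continuous_const.mul (hF p)) hG ?_ ha hb
  intro s t
  refine (hfs s t).trans_eq ?_
  rw [Finset.sum_product]
  refine Finset.sum_congr rfl fun i _ => ?_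
  simp only [Fin.sum_univ_three, F, G, Matrix.cons_val]
  ring

theorem sum_l2Norm_cfc_sub_sq_le (h : IsFaithfulTracialState τ) {ι : Type*} (I : Finset ι)
    {f : ι → ℝ → ℝ} (hf : ∀ i, Continuous (f i))
    (hfs : ∀ s t, ∑ i ∈ I, (f i s - f i t) ^ 2 ≤ (s - t) ^ 2) {a b : A} (ha : IsSelfAdjoint a)
    (hb : IsSelfAdjoint b) :
    ∑ i ∈ I, l2Norm τ (cfc (f i) a - cfc (f i) b) ^ 2 ≤ l2Norm τ (a - b) ^ 2 := by
  -- The index `none` carries the identity function with weight 1, the others carry weight -1.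
  have := h.sum_mul_l2Norm_cfc_sub_sq_nonneg (Finset.insertNone I)
    (fun o => o.elim 1 fun _ => -1) (f := fun o => o.elim (fun s => s) f)
    (by rintro (_ | i); exacts [continuous_id, hf i])
    (by intro s t; simpa [Finset.sum_insertNone] using hfs s t) ha hb
  simpa [Finset.sum_insertNone, cfc_id' ℝ a, cfc_id' ℝ b] using this

end IsFaithfulTracialState

/-! ### Slicing |s| at geometric heights -/

/-- Truncation of `|s|` at height `(1 + η) ^ k`. -/
noncomputable def trunc (η : ℝ) (k : ℕ) (s : ℝ) : ℝ := min |s| ((1 + η) ^ k)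

/-- The piecewise linear function of `|s|` climbing from `0` at `(1 + η) ^ k` to `1` at
`(1 + η) ^ (k + 1)`. -/
noncomputable def ramp (η : ℝ) (k : ℕ) (s : ℝ) : ℝ :=
  (trunc η (k + 1) s - trunc η k s) / (η * (1 + η) ^ k)

section ramp

variable {η : ℝ} (hη : 0 < η)

lemma continuous_trunc (k : ℕ) : Continuous (trunc η k) := by unfold trunc; fun_prop

lemma continuous_ramp (k : ℕ) : Continuous (ramp η k) :=
  ((continuous_trunc _).sub (continuous_trunc _)).div_const _

include hη

lemma ramp_width_pos (k : ℕ) : 0 < η * (1 + η) ^ k := by positivity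

lemma mul_ramp (k : ℕ) (s : ℝ) :
    η * (1 + η) ^ k * ramp η k s = trunc η (k + 1) s - trunc η k s :=
  mul_div_cancel₀ _ (ramp_width_pos hη k).ne'

lemma pow_lt_pow_one_add (k : ℕ) : (1 + η) ^ (k + 1) = (1 + η) ^ k + η * (1 + η) ^ k := by ring

lemma ramp_eq_zero {k : ℕ} {s : ℝ} (hs : |s| ≤ (1 + η) ^ k) : ramp η k s = 0 := by
  have h1 := pow_lt_pow_one_add hη k
  have h2 := ramp_width_pos hη k
  rw [ramp, trunc, trunc, min_eq_left hs, min_eq_left (by linarith), sub_self, zero_div]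

lemma ramp_eq_one {k : ℕ} {s : ℝ} (hs : (1 + η) ^ (k + 1) ≤ |s|) : ramp η k s = 1 := by
  have h1 := pow_lt_pow_one_add hη k
  have h2 := ramp_width_pos hη k
  rw [ramp, trunc, trunc, min_eq_right hs, min_eq_right (by linarith),
    div_eq_one_iff_eq h2.ne']
  linarith

lemma ramp_nonneg (k : ℕ) (s : ℝ) : 0 ≤ ramp η k s := by
  have h1 := pow_lt_pow_one_add hη k
  have h2 := ramp_width_pos hη k
  refine div_nonneg (sub_nonneg.mpr ?_) h2.le
  exact min_le_min le_rfl (by linarith)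

lemma ramp_le_one (k : ℕ) (s : ℝ) : ramp η k s ≤ 1 := by
  have h1 := pow_lt_pow_one_add hη k
  have h2 := ramp_width_pos hη k
  refine (div_le_one h2).mpr ?_
  unfold trunc
  rcases le_total |s| ((1 + η) ^ k) with h | h
  · rw [min_eq_left h, min_eq_left (by linarith)]; linarith
  · rw [min_eq_right h]; linarith [min_le_right |s| ((1 + η) ^ (k + 1))]

/-- A ramp is already 1 where the next one starts. Consequently the failure of a ramp to be a
projection is bounded by the drop in trace to the next ramp. -/
lemma ramp_succ_le_sq (k : ℕ) (s : ℝ) : ramp η (k + 1) s ≤ ramp η k s * ramp η k s := by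
  rcases le_total |s| ((1 + η) ^ (k + 1)) with h | h
  · rw [ramp_eq_zero hη h]; exact mul_self_nonneg _
  · rw [ramp_eq_one hη h, one_mul]; exact ramp_le_one hη _ _

/-- Every ramp lives where |s| ≥ 1, so its trace is controlled by the mass of the truncation at
height 1. -/
lemma ramp_le_trunc_zero_sq (k : ℕ) (s : ℝ) : ramp η k s ≤ trunc η 0 s * trunc η 0 s := by
  have h1 : 1 ≤ (1 + η) ^ k := one_le_pow₀ (by linarith)
  rcases le_total |s| 1 with h | h
  · rw [ramp_eq_zero hη (h.trans h1)]; exact mul_self_nonneg _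
  · rw [trunc, pow_zero, min_eq_right h, one_mul]; exact ramp_le_one hη _ _

lemma sum_mul_ramp (M : ℕ) (s : ℝ) :
    ∑ k ∈ Finset.range M, η * (1 + η) ^ k * ramp η k s = trunc η M s - trunc η 0 s := by
  rw [← Finset.sum_range_sub (fun k => trunc η k s)]
  exact Finset.sum_congr rfl fun k _ => mul_ramp hη k s

lemma ramp_mono {s t : ℝ} (hst : |s| ≤ |t|) (k : ℕ) : ramp η k s ≤ ramp η k t := by
  rcases le_total |s| ((1 + η) ^ k) with h | h
  · rw [ramp_eq_zero hη h]; exact ramp_nonneg hη _ _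
  · refine div_le_div_of_nonneg_right ?_ (ramp_width_pos hη k).le
    rw [trunc, trunc, trunc, trunc, min_eq_right h, min_eq_right (h.trans hst)]
    exact sub_le_sub_right (min_le_min hst le_rfl) _

/-- For |t| ≤ |s| all increments are nonnegative, so the sum of squares is at most the square of the
sum, and the sum telescopes to something at most |s| - |t|. -/
lemma sum_ramp_sub_sq_le (M : ℕ) (s t : ℝ) :
    ∑ k ∈ Finset.range M, (η * (1 + η) ^ k * ramp η k s - η * (1 + η) ^ k * ramp η k t) ^ 2
      ≤ (s - t) ^ 2 := by
  wlog hst : |t| ≤ |s| generalizing s t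
  · have := this t s (le_of_not_ge hst)
    calc _ = _ := Finset.sum_congr rfl fun k _ => by ring
      _ ≤ _ := this
      _ = _ := by ring
  have h0 : ∀ k ∈ Finset.range M,
      0 ≤ η * (1 + η) ^ k * ramp η k s - η * (1 + η) ^ k * ramp η k t := fun k _ =>
    sub_nonneg.mpr (mul_le_mul_of_nonneg_left (ramp_mono hη hst k) (ramp_width_pos hη k).le)
  refine (Finset.sum_sq_le_sq_sum_of_nonneg h0).trans ?_
  have h1 := Finset.sum_nonneg h0
  rw [← sq_abs (s - t)]
  refine pow_le_pow_left₀ h1 ?_ 2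
  rw [Finset.sum_sub_distrib, sum_mul_ramp hη, sum_mul_ramp hη]
  have h2 : trunc η 0 t ≤ trunc η 0 s := min_le_min hst le_rfl
  have h3 : trunc η M s - trunc η M t ≤ |s| - |t| := by
    unfold trunc
    rcases le_total |t| ((1 + η) ^ M) with h | h
    · rw [min_eq_left h]; linarith [min_le_left |s| ((1 + η) ^ M)]
    · rw [min_eq_right h, min_eq_right (h.trans hst)]; linarith
  linarith [abs_sub_abs_le_abs_sub s t]

/-- Factor the difference of consecutive squares: the difference of truncations is width times ramp,
and their sum is at most (2 + η)(1 + η)^M, which is (2 + η)/η times the width. -/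
lemma trunc_sq_le (M : ℕ) (s : ℝ) :
    trunc η M s * trunc η M s ≤ trunc η 0 s * trunc η 0 s +
      ∑ k ∈ Finset.range M, ((2 + η) / η * (η * (1 + η) ^ k) ^ 2) * ramp η k s := by
  induction M with
  | zero => simp
  | succ M ih =>
    rw [Finset.sum_range_succ]
    have h1 := mul_ramp hη M s
    have h2 := ramp_nonneg hη M s
    have h3 : trunc η (M + 1) s + trunc η M s ≤ (1 + η) ^ (M + 1) + (1 + η) ^ M :=
      add_le_add (min_le_right _ _) (min_le_right _ _)
    have h4 : trunc η (M + 1) s * trunc η (M + 1) s - trunc η M s * trunc η M s =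
        (η * (1 + η) ^ M * ramp η M s) * (trunc η (M + 1) s + trunc η M s) := by rw [h1]; ring
    have h5 : ((2 + η) / η * (η * (1 + η) ^ M) ^ 2) * ramp η M s =
        (η * (1 + η) ^ M * ramp η M s) * ((1 + η) ^ (M + 1) + (1 + η) ^ M) := by
      field_simp; ring
    have h6 := mul_le_mul_of_nonneg_left h3 (mul_nonneg (ramp_width_pos hη M).le h2)
    linarith

/-- Summation by parts. The weights have constant ratio r = (1 + η)⁻², so the drops contribute only
the fraction 1 - r ≤ 2η of the weighted total, plus a boundary term. -/
lemma sum_ramp_width_sq_mul_sub_le (T : ℕ → ℝ) (hT : ∀ k, 0 ≤ T k) (M : ℕ) :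
    ∑ k ∈ Finset.range M, (η * (1 + η) ^ k) ^ 2 * (T k - T (k + 1)) ≤
      η ^ 2 * T 0 + 2 * η * ∑ k ∈ Finset.range M, (η * (1 + η) ^ k) ^ 2 * T k := by
  set r : ℝ := 1 / (1 + η) ^ 2 with hr
  have hrw : ∀ k, r * (η * (1 + η) ^ (k + 1)) ^ 2 = (η * (1 + η) ^ k) ^ 2 := by
    intro k; rw [hr]; field_simp; ring
  have hr0 : 0 ≤ r := by positivity
  have hr1 : 1 - r ≤ 2 * η := by
    rw [hr, sub_le_iff_le_add, ← sub_le_iff_le_add', le_div_iff₀ (by positivity)]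
    nlinarith [sq_nonneg η, mul_pos hη hη, pow_pos hη 3]
  have hr2 : r ≤ 1 := by
    rw [hr, div_le_one (by positivity)]; nlinarith
  have key : ∑ k ∈ Finset.range M, (η * (1 + η) ^ k) ^ 2 * (T k - T (k + 1)) +
      r * (η * (1 + η) ^ M) ^ 2 * T M ≤
      η ^ 2 * T 0 + (1 - r) * ∑ k ∈ Finset.range M, (η * (1 + η) ^ k) ^ 2 * T k := by
    induction M with
    | zero =>
      have := mul_le_mul_of_nonneg_right hr2 (mul_nonneg (sq_nonneg η) (hT 0))
      simp; linarith
    | succ M ih =>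
      rw [Finset.sum_range_succ, Finset.sum_range_succ, hrw]
      linarith
  have h1 : 0 ≤ r * (η * (1 + η) ^ M) ^ 2 * T M := mul_nonneg (by positivity) (hT M)
  have h2 : 0 ≤ ∑ k ∈ Finset.range M, (η * (1 + η) ^ k) ^ 2 * T k :=
    Finset.sum_nonneg fun k _ => mul_nonneg (sq_nonneg _) (hT k)
  nlinarith

end ramp

/-! ### Choosing a good cutoff height -/

namespace IsFaithfulTracialState

variable {A : Type*} [CStarAlgebra A] [PartialOrder A] [StarOrderedRing A] {τ : A →ₗ[ℂ] ℂ}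

lemma re_smul_real (r : ℝ) (x : A) : (τ (r • x)).re = r * (τ x).re := by
  rw [← Complex.coe_smul, map_smul, smul_eq_mul, Complex.re_ofReal_mul]

lemma l2Norm_cfc_sq (h : IsFaithfulTracialState τ) {φ : ℝ → ℝ} (hφ : Continuous φ) (x : A) :
    l2Norm τ (cfc φ x) ^ 2 = (τ (cfc (fun s => φ s * φ s) x)).re := by
  rw [h.l2Norm_sq_of_isSelfAdjoint (cfc_predicate φ x),
    cfc_mul φ φ x hφ.continuousOn hφ.continuousOn]

lemma re_cfc_mono (h : IsFaithfulTracialState τ) {φ ψ : ℝ → ℝ} (hφ : Continuous φ)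
    (hψ : Continuous ψ) {x : A} (hle : ∀ s ∈ spectrum ℝ x, φ s ≤ ψ s) :
    (τ (cfc φ x)).re ≤ (τ (cfc ψ x)).re :=
  h.re_mono (cfc_mono hle hφ.continuousOn hψ.continuousOn)

lemma re_cfc_nonneg (h : IsFaithfulTracialState τ) {φ : ℝ → ℝ} {x : A} (hle : ∀ s, 0 ≤ φ s) :
    0 ≤ (τ (cfc φ x)).re := h.re_nonneg (cfc_nonneg fun s _ => hle s)

/-- The spectrum of x lies below the top height, where truncation is |s|, so `trunc_sq_le` applies
on it. When the low part is small, the ramps must carry the mass. -/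
lemma one_le_trunc_sum (h : IsFaithfulTracialState τ) {η : ℝ} (hη : 0 < η) {x : A}
    (hx : IsSelfAdjoint x) {M : ℕ} (hM : ‖x‖ ≤ (1 + η) ^ M) :
    l2Norm τ x ^ 2 ≤ l2Norm τ (cfc (trunc η 0) x) ^ 2 + (2 + η) / η *
      ∑ k ∈ Finset.range M, (η * (1 + η) ^ k) ^ 2 * (τ (cfc (ramp η k) x)).re := by
  have := h.nontrivial
  have e1 : l2Norm τ x ^ 2 = (τ (cfc (fun s : ℝ => s * s) x)).re := by
    rw [← h.l2Norm_cfc_sq continuous_id' x, cfc_id' ℝ x]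
  have hc0 := continuous_trunc (η := η) 0
  have hck := continuous_ramp (η := η)
  have hcs : Continuous (∑ k ∈ Finset.range M, fun s =>
      ((2 + η) / η * (η * (1 + η) ^ k) ^ 2) * ramp η k s) := by
    rw [show (∑ k ∈ Finset.range M, fun s => ((2 + η) / η * (η * (1 + η) ^ k) ^ 2) * ramp η k s) =
      fun s => ∑ k ∈ Finset.range M, ((2 + η) / η * (η * (1 + η) ^ k) ^ 2) * ramp η k s by
        ext s; simp]
    fun_prop
  rw [e1, h.l2Norm_cfc_sq hc0, Finset.mul_sum]
  have e2 : (τ (cfc (fun s => trunc η 0 s * trunc η 0 s + (∑ k ∈ Finset.range M, fun s =>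
      ((2 + η) / η * (η * (1 + η) ^ k) ^ 2) * ramp η k s) s) x)).re =
      (τ (cfc (fun s => trunc η 0 s * trunc η 0 s) x)).re + ∑ k ∈ Finset.range M,
        (2 + η) / η * ((η * (1 + η) ^ k) ^ 2 * (τ (cfc (ramp η k) x)).re) := by
    rw [cfc_add x (fun s => trunc η 0 s * trunc η 0 s) _ (hc0.mul hc0).continuousOn hcs.continuousOn,
      cfc_sum _ x _ (fun k _ => Continuous.continuousOn (by have := hck; fun_prop)), map_add, map_sum,
      Complex.add_re, Complex.re_sum]
    congr 1
    refine Finset.sum_congr rfl fun k _ => ?_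
    rw [cfc_const_mul _ _ x (hck k).continuousOn, re_smul_real]
    ring
  rw [← e2]
  refine h.re_cfc_mono (by fun_prop) ((hc0.mul hc0).add hcs) fun s hs => ?_
  have hs' : |s| ≤ (1 + η) ^ M := (spectrum.norm_le_norm_of_mem hs).trans hM
  have h3 := trunc_sq_le hη M s
  rw [trunc, min_eq_left hs', abs_mul_abs_self] at h3
  simpa [Finset.sum_apply] using h3

/-- Cutting a self-adjoint element at a suitable height: if the mass of `x` lies at large
heights and `x` is close in `2`-norm to finitely many other elements, then some bounded function
of `x` is almost a projection of small trace and is relatively close to the same function of the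
other elements. -/
theorem exists_cutoff (h : IsFaithfulTracialState τ) (ι : Type*) [Fintype ι] {δ : ℝ}
    (hδ : 0 < δ) : ∃ ε > 0, ∀ (x : A) (y : ι → A),
      IsSelfAdjoint x → (∀ i, IsSelfAdjoint (y i)) → l2Norm τ x = 1 →
      l2Norm τ (cfc (fun s : ℝ => min |s| 1) x) ^ 2 ≤ ε →
      (∀ i, l2Norm τ (y i - x) ^ 2 ≤ ε) →
      ∃ φ : ℝ → ℝ, Continuous φ ∧ (∀ s, 0 ≤ φ s ∧ φ s ≤ 1) ∧ 0 < l2Norm τ (cfc φ x) ∧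
        (∀ i, l2Norm τ (cfc φ (y i) - cfc φ x) ^ 2 ≤ δ * l2Norm τ (cfc φ x) ^ 2) ∧
        (τ (cfc φ x)).re - l2Norm τ (cfc φ x) ^ 2 ≤ δ * l2Norm τ (cfc φ x) ^ 2 ∧
        l2Norm τ (cfc φ x) ^ 2 ≤ δ := by
  set n : ℕ := Fintype.card ι with hι
  set d : ℝ := min δ 1 / 2 with hd
  have hd0 : 0 < d := by have := lt_min hδ one_pos; positivity
  have hd1 : d ≤ 1 / 2 := by have := min_le_right δ 1; rw [hd]; linarith
  have hdδ : 2 * d ≤ δ := by have := min_le_left δ 1; rw [hd]; linarith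
  -- With η = d/4 the loss 2η in the summation by parts is half of d. The ε below gives (n + 1)ε =
  -- d²/100, less than the d²/48 that failure at every height would force.
  set η : ℝ := d / 4 with hηd
  have hη : 0 < η := by positivity
  refine ⟨d ^ 2 / (100 * (n + 1)), by positivity, ?_⟩
  set ε : ℝ := d ^ 2 / (100 * (n + 1)) with hε
  intro x y hx hy hx1 hxm hxy
  have hnε : (n + 1) * ε = d ^ 2 / 100 := by rw [hε]; field_simp
  have hε0 : 0 < ε := by positivity
  have hεd : ε ≤ d ^ 2 / 100 := by
    rw [← hnε]; nlinarith [(Nat.cast_nonneg n : (0 : ℝ) ≤ n)]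
  have htr : (fun s : ℝ => min |s| 1) = trunc η 0 := by ext s; simp [trunc]
  rw [htr] at hxm
  set T : ℕ → ℝ := fun k => (τ (cfc (ramp η k) x)).re with hTdef
  have hT0 : ∀ k, 0 ≤ T k := fun k => h.re_cfc_nonneg (ramp_nonneg hη k)
  have hTε : ∀ k, T k ≤ ε := fun k => by
    refine le_trans ?_ hxm
    rw [h.l2Norm_cfc_sq (continuous_trunc 0)]
    exact h.re_cfc_mono (continuous_ramp k) ((continuous_trunc 0).mul (continuous_trunc 0))
      fun s _ => ramp_le_trunc_zero_sq hη k s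
  set Q : ℕ → ℝ := fun k => l2Norm τ (cfc (ramp η k) x) ^ 2 with hQdef
  have hQT : ∀ k, T (k + 1) ≤ Q k := fun k => by
    rw [hQdef]; simp only
    rw [h.l2Norm_cfc_sq (continuous_ramp k)]
    exact h.re_cfc_mono (continuous_ramp _) ((continuous_ramp k).mul (continuous_ramp k))
      fun s _ => ramp_succ_le_sq hη k s
  have hQT' : ∀ k, Q k ≤ T k := fun k => by
    rw [hQdef]; simp only
    rw [h.l2Norm_cfc_sq (continuous_ramp k)]
    refine h.re_cfc_mono ((continuous_ramp k).mul (continuous_ramp k)) (continuous_ramp _)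
      fun s _ => mul_le_of_le_one_left (ramp_nonneg hη k s) (ramp_le_one hη k s)
  obtain ⟨M, hM⟩ := pow_unbounded_of_one_lt ‖x‖ (by linarith : 1 < 1 + η)
  have hW := h.one_le_trunc_sum hη hx hM.le
  set W := ∑ k ∈ Finset.range M, (η * (1 + η) ^ k) ^ 2 * T k with hWdef
  have hAbel := sum_ramp_width_sq_mul_sub_le hη T hT0 M
  have hinc : ∀ i, ∑ k ∈ Finset.range M, (η * (1 + η) ^ k) ^ 2 *
      l2Norm τ (cfc (ramp η k) (y i) - cfc (ramp η k) x) ^ 2 ≤ ε := fun i => by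
    have := h.sum_l2Norm_cfc_sub_sq_le (Finset.range M)
      (f := fun k s => η * (1 + η) ^ k * ramp η k s)
      (fun k => continuous_const.mul (continuous_ramp k)) (sum_ramp_sub_sq_le hη M) (hy i) hx
    refine le_trans (le_of_eq ?_) (this.trans (hxy i))
    refine Finset.sum_congr rfl fun k _ => ?_
    rw [cfc_const_mul _ _ x (continuous_ramp k).continuousOn,
      cfc_const_mul _ _ (y i) (continuous_ramp k).continuousOn, ← smul_sub, ← Complex.coe_smul,
      h.l2Norm_smul, Complex.norm_real, Real.norm_eq_abs, mul_pow |_|, sq_abs]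
  -- If every height failed, summing with the squared widths as weights would bound d·W by the total
  -- displacement, at most nε, plus the weighted drops, at most ε + 2ηW.
  have hex : ∃ k, 0 < T k ∧ ∑ i, l2Norm τ (cfc (ramp η k) (y i) - cfc (ramp η k) x) ^ 2 +
      (T k - T (k + 1)) ≤ d * T k := by
    by_contra hcon
    push Not at hcon
    have hk : ∀ k, d * T k - (T k - T (k + 1)) ≤
        ∑ i, l2Norm τ (cfc (ramp η k) (y i) - cfc (ramp η k) x) ^ 2 := by
      intro k
      rcases (hT0 k).lt_or_eq with hk | hk
      · linarith [hcon k hk]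
      · rw [← hk]
        have h1 : T (k + 1) ≤ 0 := by rw [hk]; exact (hQT k).trans (hQT' k)
        have h2 : 0 ≤ ∑ i, l2Norm τ (cfc (ramp η k) (y i) - cfc (ramp η k) x) ^ 2 :=
          Finset.sum_nonneg fun i _ => sq_nonneg _
        linarith
    have hsum : d * W - ∑ k ∈ Finset.range M, (η * (1 + η) ^ k) ^ 2 * (T k - T (k + 1)) ≤
        n * ε := by
      calc _ = ∑ k ∈ Finset.range M, (η * (1 + η) ^ k) ^ 2 * (d * T k - (T k - T (k + 1))) := by
            rw [hWdef, Finset.mul_sum, ← Finset.sum_sub_distrib]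
            exact Finset.sum_congr rfl fun k _ => by ring
        _ ≤ ∑ k ∈ Finset.range M, (η * (1 + η) ^ k) ^ 2 *
            ∑ i, l2Norm τ (cfc (ramp η k) (y i) - cfc (ramp η k) x) ^ 2 :=
          Finset.sum_le_sum fun k _ => mul_le_mul_of_nonneg_left (hk k) (sq_nonneg _)
        _ = ∑ i, ∑ k ∈ Finset.range M, (η * (1 + η) ^ k) ^ 2 *
            l2Norm τ (cfc (ramp η k) (y i) - cfc (ramp η k) x) ^ 2 := by
          simp only [Finset.mul_sum]; exact Finset.sum_comm
        _ ≤ ∑ i : ι, ε := Finset.sum_le_sum fun i _ => hinc i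
        _ = n * ε := by simp [n]
    rw [hx1] at hW
    have hη1 : η ≤ 1 / 8 := by rw [hηd]; linarith
    -- The truncation at height 1 carries at most half of ‖x‖₂² = 1, so (2 + η)/η · W ≥ 1/2.
    have hW2 : η / 6 ≤ W := by
      have h1 : (1 : ℝ) / 2 ≤ (2 + η) / η * W := by
        have : d ^ 2 ≤ 1 := pow_le_one₀ hd0.le (by linarith)
        linarith
      rw [div_mul_eq_mul_div, le_div_iff₀ hη] at h1
      nlinarith
    have h0ε := hTε 0
    have hT00 := hT0 0
    have hηT : η ^ 2 * T 0 ≤ ε :=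
      (mul_le_of_le_one_left hT00 (pow_le_one₀ hη.le (by linarith))).trans h0ε
    have : d * W - 2 * η * W ≤ n * ε + ε := by linarith
    have h3 : d * W - 2 * η * W = d / 2 * W := by rw [hηd]; ring
    have h4 : d / 2 * (d / 24) ≤ d / 2 * W := by
      refine mul_le_mul_of_nonneg_left ?_ (by positivity)
      rw [hηd] at hW2; linarith
    nlinarith
  obtain ⟨k, hTk, hk⟩ := hex
  have hinc0 : ∀ i, l2Norm τ (cfc (ramp η k) (y i) - cfc (ramp η k) x) ^ 2 ≤
      ∑ i, l2Norm τ (cfc (ramp η k) (y i) - cfc (ramp η k) x) ^ 2 := fun i =>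
    Finset.single_le_sum (f := fun i => l2Norm τ (cfc (ramp η k) (y i) - cfc (ramp η k) x) ^ 2)
      (fun i _ => sq_nonneg _) (Finset.mem_univ i)
  have hsum0 : 0 ≤ ∑ i, l2Norm τ (cfc (ramp η k) (y i) - cfc (ramp η k) x) ^ 2 :=
    Finset.sum_nonneg fun i _ => sq_nonneg _
  have hQ := hQT k
  have hQ' := hQT' k
  have hTT : T (k + 1) ≤ T k := hQ.trans hQ'
  have hTQ : T k ≤ 2 * Q k := by nlinarith
  have hdT : d * T k ≤ δ * Q k := by nlinarith
  refine ⟨ramp η k, continuous_ramp k, fun s => ⟨ramp_nonneg hη k s, ramp_le_one hη k s⟩,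
    ?_, fun i => ?_, ?_, ?_⟩
  · have : 0 < Q k := by linarith
    exact lt_of_le_of_ne (l2Norm_nonneg _) fun h0 => by
      rw [hQdef] at this; simp only [← h0] at this; norm_num at this
  · have := hinc0 i
    change _ ≤ δ * Q k
    linarith
  · change T k - Q k ≤ δ * Q k
    linarith
  · change Q k ≤ δ
    have := hTε k
    nlinarith

end IsFaithfulTracialState

/-! ### Enlarging an almost projection: estimates for one step -/

lemma StarAlgEquiv.apply_one {A : Type*} [CStarAlgebra A] (θ : A ≃⋆ₐ[ℂ] A) : θ 1 = 1 := by
  obtain ⟨x, hx⟩ := EquivLike.surjective θ 1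
  have : θ 1 * θ x = θ x := by rw [← map_mul, one_mul]
  rwa [hx, mul_one] at this

namespace IsFaithfulTracialState

variable {A : Type*} [CStarAlgebra A] [PartialOrder A] [StarOrderedRing A] {τ : A →ₗ[ℂ] ℂ}

lemma abs_re_mul_mul_le (h : IsFaithfulTracialState τ) (a b c : A) :
    |(τ (a * (b * c))).re| ≤ ‖a‖ * (l2Norm τ b * l2Norm τ c) := by
  rw [← mul_assoc, ← mul_assoc]
  exact (h.abs_re_mul_le _ _).trans
    (mul_le_mul_of_nonneg_right (h.l2Norm_mul_le a b) (l2Norm_nonneg c))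

lemma l2Norm_add_sq (h : IsFaithfulTracialState τ) {x y : A} (hx : IsSelfAdjoint x)
    (hy : IsSelfAdjoint y) :
    l2Norm τ (x + y) ^ 2 = l2Norm τ x ^ 2 + 2 * (τ (x * y)).re + l2Norm τ y ^ 2 := by
  rw [h.l2Norm_sq_of_isSelfAdjoint (hx.add hy), h.l2Norm_sq_of_isSelfAdjoint hx,
    h.l2Norm_sq_of_isSelfAdjoint hy]
  simp only [add_mul, mul_add, map_add, h.tracial y x, Complex.add_re]
  ring

lemma mul_self_le_self {a : A} (h0 : 0 ≤ a) (h1 : a ≤ 1) : a * a ≤ a := by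
  have : 0 ≤ a * (1 - a) := Commute.mul_nonneg h0 (sub_nonneg.mpr h1)
    ((Commute.one_right a).sub_right (Commute.refl a))
  rwa [mul_sub, mul_one, sub_nonneg] at this

lemma norm_le_one_of_nonneg {a : A} (h0 : 0 ≤ a) (h1 : a ≤ 1) : ‖a‖ ≤ 1 :=
  (CStarAlgebra.norm_le_one_iff_of_nonneg a h0).mpr h1

lemma norm_le_one_of_mul_self {r q : A} (hr : IsSelfAdjoint r) (hrq : r * r = 1 - q) (h0 : 0 ≤ q)
    (h1 : q ≤ 1) : ‖r‖ ≤ 1 := by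
  have h2 : ‖r‖ * ‖r‖ ≤ 1 := by
    rw [← CStarRing.norm_star_mul_self, hr.star_eq, hrq]
    exact norm_le_one_of_nonneg (sub_nonneg.mpr h1) (sub_le_self 1 h0)
  nlinarith [norm_nonneg r]

section conj

variable {s y Y : A} {δ : ℝ}

/-- If `Y` is close to `y` and `y` almost commutes with `s` then `s Y² s` is close to `s² y²`, both
in `2`-norm and as a functional. -/
lemma conj_sub_estimates (h : IsFaithfulTracialState τ) (hδ1 : δ ≤ 1) (hs : ‖s‖ ≤ 1)
    (hy : ‖y‖ ≤ 1) (hY : ‖Y‖ ≤ 1) (hYy : l2Norm τ (Y - y) ≤ δ * l2Norm τ y)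
    (hsy : l2Norm τ (s * y - y * s) ≤ δ * l2Norm τ y) :
    l2Norm τ (s * (Y * Y) * s - s * s * (y * y)) ≤ 4 * δ * l2Norm τ y ∧
    ∀ z : A, |(τ (z * (s * (Y * Y) * s - s * s * (y * y)))).re| ≤
      ‖z‖ * (5 * δ * l2Norm τ y ^ 2) := by
  set n := l2Norm τ y with hn
  have hn0 : 0 ≤ n := l2Norm_nonneg y
  have hsy' : l2Norm τ (y * s - s * y) ≤ δ * n := by rwa [l2Norm_sub_comm]
  -- Each summand splits into two factors, one of 2-norm at most δn. Bounding one factor in operator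
  -- norm gives order δn; paired with z, both factors are measured in 2-norm, which gives the order
  -- δn² needed later.
  have e : s * (Y * Y) * s - s * s * (y * y) =
      s * (Y - y) * (Y * s) + s * y * ((Y - y) * s) + s * y * (y * s - s * y)
        + s * (y * s - s * y) * y := by noncomm_ring
  have hY2 : l2Norm τ Y ≤ 2 * n := by
    have := h.l2Norm_add_le (Y - y) y
    rw [sub_add_cancel] at this
    nlinarith
  have a1 : l2Norm τ (s * (Y - y)) ≤ δ * n := (h.l2Norm_mul_le_of_norm_le_one hs _).trans hYy
  have a2 : l2Norm τ (Y * s) ≤ 2 * n := (h.l2Norm_mul_le_of_norm_le_one' hs _).trans hY2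
  have a3 : l2Norm τ (s * y) ≤ n := h.l2Norm_mul_le_of_norm_le_one hs _
  have a4 : l2Norm τ ((Y - y) * s) ≤ δ * n := (h.l2Norm_mul_le_of_norm_le_one' hs _).trans hYy
  have a5 : l2Norm τ (s * (y * s - s * y)) ≤ δ * n :=
    (h.l2Norm_mul_le_of_norm_le_one hs _).trans hsy'
  have b1 : ‖Y * s‖ ≤ 1 := (norm_mul_le _ _).trans (mul_le_one₀ hY (norm_nonneg _) hs)
  have b2 : ‖s * y‖ ≤ 1 := (norm_mul_le _ _).trans (mul_le_one₀ hs (norm_nonneg _) hy)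
  have hδn : 0 ≤ δ * n := (l2Norm_nonneg _).trans hYy
  rw [e]
  constructor
  · have c1 := (h.l2Norm_mul_le_of_norm_le_one' b1 (s * (Y - y))).trans a1
    have c2 := (h.l2Norm_mul_le_of_norm_le_one b2 ((Y - y) * s)).trans a4
    have c3 := (h.l2Norm_mul_le_of_norm_le_one b2 (y * s - s * y)).trans hsy'
    have c4 := (h.l2Norm_mul_le_of_norm_le_one' hy (s * (y * s - s * y))).trans a5
    have d1 := h.l2Norm_add_le (s * (Y - y) * (Y * s) + s * y * ((Y - y) * s) +
      s * y * (y * s - s * y)) (s * (y * s - s * y) * y)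
    have d2 := h.l2Norm_add_le (s * (Y - y) * (Y * s) + s * y * ((Y - y) * s))
      (s * y * (y * s - s * y))
    have d3 := h.l2Norm_add_le (s * (Y - y) * (Y * s)) (s * y * ((Y - y) * s))
    linarith
  · intro z
    have hz := norm_nonneg z
    have key : ∀ {b c : A} {β γ : ℝ}, l2Norm τ b ≤ β → l2Norm τ c ≤ γ →
        |(τ (z * (b * c))).re| ≤ ‖z‖ * (β * γ) := fun {b c β γ} hb hc =>
      (h.abs_re_mul_mul_le z b c).trans <| mul_le_mul_of_nonneg_left
        (mul_le_mul hb hc (l2Norm_nonneg c) ((l2Norm_nonneg b).trans hb)) hz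
    have c1 := key a1 a2
    have c2 := key a3 a4
    have c3 := key a3 hsy'
    have c4 := key a5 (le_refl n)
    simp only [mul_add z, map_add, Complex.add_re]
    have d1 := abs_add_le ((τ (z * (s * (Y - y) * (Y * s)))).re +
      (τ (z * (s * y * ((Y - y) * s)))).re + (τ (z * (s * y * (y * s - s * y)))).re)
      (τ (z * (s * (y * s - s * y) * y))).re
    have d2 := abs_add_le ((τ (z * (s * (Y - y) * (Y * s)))).re +
      (τ (z * (s * y * ((Y - y) * s)))).re) (τ (z * (s * y * (y * s - s * y)))).re
    have d3 := abs_add_le (τ (z * (s * (Y - y) * (Y * s)))).re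
      (τ (z * (s * y * ((Y - y) * s)))).re
    linarith

end conj

section extension

variable {q r y : A} {δ : ℝ}

lemma re_extension (h : IsFaithfulTracialState τ) (hr : IsSelfAdjoint r) (hy : IsSelfAdjoint y) :
    (τ (q + r * (y * y) * r)).re = (τ q).re + l2Norm τ (r * y) ^ 2 := by
  rw [h.l2Norm_sq, star_mul, hr.star_eq, hy.star_eq, map_add, Complex.add_re, mul_assoc y,
    h.tracial y, h.tracial _ r]
  simp only [mul_assoc]

/-- With a = 1 - q and P = r y² r, the defect grows by -(τ(ay²) - τ(a²y²)) + (τ(a²y²) - ‖P‖₂²). The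
first part is nonpositive as a² ≤ a. In the second, ‖P‖₂² is close to τ(a²y⁴), and a² ≤ 1 bounds
τ(a²(y² - y⁴)) by the defect of y. -/
lemma extension_defect (h : IsFaithfulTracialState τ) (hδ1 : δ ≤ 1) (hq0 : 0 ≤ q) (hq1 : q ≤ 1)
    (hr : IsSelfAdjoint r) (hrq : r * r = 1 - q) (hy0 : 0 ≤ y) (hy1 : y ≤ 1)
    (hry : l2Norm τ (r * y - y * r) ≤ δ * l2Norm τ y)
    (hproj : l2Norm τ y ^ 2 - l2Norm τ (y * y) ^ 2 ≤ δ * l2Norm τ y ^ 2) :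
    (τ (q + r * (y * y) * r)).re - l2Norm τ (q + r * (y * y) * r) ^ 2 ≤
      (τ q).re - l2Norm τ q ^ 2 + 9 * δ * l2Norm τ y ^ 2 := by
  have hys : IsSelfAdjoint y := IsSelfAdjoint.of_nonneg hy0
  have hyys : IsSelfAdjoint (y * y) := by simpa [hys.star_eq] using IsSelfAdjoint.star_mul_self y
  have hqs : IsSelfAdjoint q := IsSelfAdjoint.of_nonneg hq0
  have hrn := norm_le_one_of_mul_self hr hrq hq0 hq1
  have hyn := norm_le_one_of_nonneg hy0 hy1
  set n := l2Norm τ y with hn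
  have hn0 : 0 ≤ n := l2Norm_nonneg y
  have hδn : 0 ≤ δ * n := (l2Norm_nonneg _).trans hry
  have hPs : IsSelfAdjoint (r * (y * y) * r) := by
    simpa [hr.star_eq] using hyys.conjugate r
  have est := (h.conj_sub_estimates hδ1 hrn hyn hyn (by rw [sub_self, l2Norm_zero]; exact hδn)
    hry).1
  set a := r * r with ha
  have ha0 : 0 ≤ a := by rw [hrq]; exact sub_nonneg.mpr hq1
  have ha1 : a ≤ 1 := by rw [hrq]; exact sub_le_self 1 hq0
  have has : IsSelfAdjoint a := IsSelfAdjoint.of_nonneg ha0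
  have haa : a * a ≤ a := mul_self_le_self ha0 ha1
  have hqa : q = 1 - a := by rw [hrq]; abel
  have hyy0 : 0 ≤ y * y := by simpa [hys.star_eq] using star_mul_self_nonneg y
  have hyy1 : y * y ≤ 1 := (mul_self_le_self hy0 hy1).trans hy1
  have hy4 : y * y * (y * y) ≤ y * y := mul_self_le_self hyy0 hyy1
  rw [h.l2Norm_add_sq hqs hPs, map_add, Complex.add_re]
  have t1 : (τ (r * (y * y) * r)).re = (τ (a * (y * y))).re := by
    rw [h.tracial, ha, mul_assoc]
  have t2 : (τ (q * (r * (y * y) * r))).re = (τ (a * (y * y))).re - (τ (a * a * (y * y))).re := by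
    rw [← Complex.sub_re, ← map_sub, show q * (r * (y * y) * r) = q * r * (y * y) * r by
      noncomm_ring, h.tracial, show r * (q * r * (y * y)) = a * (y * y) - a * a * (y * y) by
        rw [hqa, ha]; noncomm_ring]
  have t3 : l2Norm τ (a * (y * y)) ^ 2 = (τ (a * a * (y * y * (y * y)))).re := by
    rw [h.l2Norm_sq, star_mul, has.star_eq, hyys.star_eq, mul_assoc (y * y), h.tracial (y * y)]
    simp only [mul_assoc]
  have haa1 : a * a ≤ 1 := haa.trans ha1
  have t4 : (τ (a * a * (y * y))).re - l2Norm τ (a * (y * y)) ^ 2 ≤ δ * n ^ 2 := by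
    refine le_trans ?_ hproj
    have := h.re_mul_nonneg (sub_nonneg.mpr haa1) (sub_nonneg.mpr hy4)
    rw [t3, h.l2Norm_sq_of_isSelfAdjoint hys, h.l2Norm_sq_of_isSelfAdjoint hyys]
    simp only [sub_mul, mul_sub, one_mul, map_sub, Complex.sub_re] at this
    linarith
  have t5 : 0 ≤ (τ (a * (y * y))).re - (τ (a * a * (y * y))).re := by
    have := h.re_mul_nonneg (sub_nonneg.mpr haa) hyy0
    simpa only [sub_mul, map_sub, Complex.sub_re] using this
  have t6 : l2Norm τ (a * (y * y)) ≤ l2Norm τ (r * (y * y) * r) + 4 * δ * n := by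
    have := h.l2Norm_sub_le (r * (y * y) * r) (r * (y * y) * r - a * (y * y))
    rw [sub_sub_cancel] at this
    linarith
  have t7 : l2Norm τ (a * (y * y)) ≤ n := by
    refine (h.l2Norm_mul_le_of_norm_le_one (norm_le_one_of_nonneg ha0 ha1) _).trans ?_
    exact h.l2Norm_mul_le_of_norm_le_one hyn _
  have t8 : l2Norm τ (a * (y * y)) ^ 2 - 8 * δ * n ^ 2 ≤ l2Norm τ (r * (y * y) * r) ^ 2 := by
    have p1 := l2Norm_nonneg (τ := τ) (a * (y * y))
    have p2 := l2Norm_nonneg (τ := τ) (r * (y * y) * r)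
    have p3 : δ * n * l2Norm τ (a * (y * y)) ≤ δ * n * n := mul_le_mul_of_nonneg_left t7 hδn
    rcases le_total (l2Norm τ (a * (y * y))) (4 * δ * n) with hle | hle
    · nlinarith
    · have p4 := pow_le_pow_left₀ (sub_nonneg.mpr hle) (sub_le_iff_le_add.mpr t6) 2
      nlinarith [sq_nonneg (4 * δ * n)]
  rw [t1, t2]
  linarith

/-- Put z = θ(q) - q, P = r y² r and E = θ(P) - P. Since P is close to (1 - q)y² and θ(P) to (1 -
θ(q))y², E is close to -zy². So the cross term 2τ(zE), about -2‖zy‖₂², absorbs ‖E‖₂², which is at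
most about ‖zy‖₂²; only errors of order δ‖y‖₂² remain. -/
lemma extension_displacement (h : IsFaithfulTracialState τ) (θ : A ≃⋆ₐ[ℂ] A) (hδ1 : δ ≤ 1)
    (hq0 : 0 ≤ q) (hq1 : q ≤ 1) (hr : IsSelfAdjoint r) (hrq : r * r = 1 - q) (hy0 : 0 ≤ y)
    (hy1 : y ≤ 1) (hry : l2Norm τ (r * y - y * r) ≤ δ * l2Norm τ y)
    (hθry : l2Norm τ (θ r * y - y * θ r) ≤ δ * l2Norm τ y)
    (hθy : l2Norm τ (θ y - y) ≤ δ * l2Norm τ y) :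
    l2Norm τ (θ (q + r * (y * y) * r) - (q + r * (y * y) * r)) ^ 2 ≤
      l2Norm τ (θ q - q) ^ 2 + 150 * δ * l2Norm τ y ^ 2 := by
  have hys : IsSelfAdjoint y := IsSelfAdjoint.of_nonneg hy0
  have hyys : IsSelfAdjoint (y * y) := by simpa [hys.star_eq] using IsSelfAdjoint.star_mul_self y
  have hqs : IsSelfAdjoint q := IsSelfAdjoint.of_nonneg hq0
  have hrn := norm_le_one_of_mul_self hr hrq hq0 hq1
  have hyn := norm_le_one_of_nonneg hy0 hy1
  have hqn := norm_le_one_of_nonneg hq0 hq1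
  have hθn : ∀ x, ‖θ x‖ ≤ ‖x‖ := fun x => NonUnitalStarAlgHom.norm_apply_le θ x
  set n := l2Norm τ y with hn
  have hn0 : 0 ≤ n := l2Norm_nonneg y
  have hδn : 0 ≤ δ * n := (l2Norm_nonneg _).trans hry
  have hPs : IsSelfAdjoint (r * (y * y) * r) := by
    simpa [hr.star_eq] using hyys.conjugate r
  obtain ⟨e1, f1⟩ := h.conj_sub_estimates hδ1 hrn hyn hyn
    (by rw [sub_self, l2Norm_zero]; exact hδn) hry
  obtain ⟨e2, f2⟩ := h.conj_sub_estimates hδ1 ((hθn r).trans hrn) hyn ((hθn y).trans hyn) hθy hθry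
  set z := θ q - q with hz
  have hzs : IsSelfAdjoint z := (hqs.map θ).sub hqs
  have hzn : ‖z‖ ≤ 2 := (norm_sub_le _ _).trans (by linarith [hθn q])
  have hθrr : θ r * θ r = 1 - θ q := by rw [← map_mul, hrq, map_sub, StarAlgEquiv.apply_one]
  set a₁ := r * (y * y) * r - r * r * (y * y) with ha₁
  set a₂ := θ r * (θ y * θ y) * θ r - θ r * θ r * (y * y) with ha₂
  set E := θ (r * (y * y) * r) - r * (y * y) * r with hE
  have hEs : IsSelfAdjoint E := (hPs.map θ).sub hPs
  have hEe : E = a₂ - a₁ - z * (y * y) := by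
    rw [hE, ha₁, ha₂, hθrr, hrq, hz]
    simp only [map_mul]
    noncomm_ring
  have hsplit : θ (q + r * (y * y) * r) - (q + r * (y * y) * r) = z + E := by
    rw [map_add, hz, hE]; abel
  rw [hsplit, h.l2Norm_add_sq hzs hEs]
  have g1 : (τ (z * (z * (y * y)))).re = l2Norm τ (z * y) ^ 2 := by
    rw [h.l2Norm_sq, star_mul, hzs.star_eq, hys.star_eq, mul_assoc y, h.tracial y]
    congr 2
    noncomm_ring
  have g2 : (τ (z * E)).re ≤ 20 * δ * n ^ 2 - l2Norm τ (z * y) ^ 2 := by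
    rw [hEe, mul_sub, mul_sub, map_sub, map_sub, Complex.sub_re, Complex.sub_re, g1]
    have p0 : 0 ≤ 5 * δ * n ^ 2 := by nlinarith
    have p1 := (f1 z).trans (mul_le_mul_of_nonneg_right hzn p0)
    have p2 := (f2 z).trans (mul_le_mul_of_nonneg_right hzn p0)
    have := abs_le.mp p1
    have := abs_le.mp p2
    linarith
  have g3 : l2Norm τ E ≤ l2Norm τ (z * y) + 8 * δ * n := by
    rw [hEe]
    have p1 := h.l2Norm_sub_le (a₂ - a₁) (z * (y * y))
    have p2 := h.l2Norm_sub_le a₂ a₁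
    have p3 : l2Norm τ (z * (y * y)) ≤ l2Norm τ (z * y) := by
      rw [← mul_assoc]; exact h.l2Norm_mul_le_of_norm_le_one' hyn _
    linarith
  have g4 : l2Norm τ (z * y) ≤ 2 * n :=
    (h.l2Norm_mul_le z y).trans (mul_le_mul_of_nonneg_right hzn hn0)
  have g5 : l2Norm τ E ^ 2 ≤ l2Norm τ (z * y) ^ 2 + 96 * δ * n ^ 2 := by
    have p1 := l2Norm_nonneg (τ := τ) (z * y)
    have p2 := pow_le_pow_left₀ (l2Norm_nonneg E) g3 2
    have p3 : δ * n * l2Norm τ (z * y) ≤ δ * n * (2 * n) := mul_le_mul_of_nonneg_left g4 hδn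
    have p4 : δ * n * (δ * n) ≤ δ * n * n := by
      refine mul_le_mul_of_nonneg_left ?_ hδn
      nlinarith
    nlinarith
  have p6 : 0 ≤ δ * n ^ 2 := by nlinarith
  nlinarith [sq_nonneg (l2Norm τ (z * y))]

end extension

end IsFaithfulTracialState

/-! ### Spectral projections, comparison, and patching by maximality -/

/-- `τ` is a faithful tracial state on a monotone complete C⋆-algebra, it preserves suprema of
directed families of positive elements, and the complement of every projection of trace at least
`1 / 2` is equivalent to a subprojection. -/
structure IsFactorTrace {A : Type*} [CStarAlgebra A] [PartialOrder A] [StarOrderedRing A]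
    (τ : A →ₗ[ℂ] ℂ) : Prop extends IsFaithfulTracialState τ where
  exists_isLUB : ∀ D : Set A, D.Nonempty → DirectedOn (· ≤ ·) D → (∀ d ∈ D, 0 ≤ d ∧ d ≤ 1) →
    ∃ a, IsLUB D a
  normal : ∀ (D : Set A) (a : A), D.Nonempty → DirectedOn (· ≤ ·) D → (∀ d ∈ D, 0 ≤ d) →
    IsLUB D a → IsLUB ((fun d => (τ d).re) '' D) (τ a).re
  exists_contraction : ∀ e : A, IsStarProjection e → 1 / 2 ≤ (τ e).re →
    ∃ v : A, ‖v‖ ≤ 1 ∧ star v * e * v = 1 - e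

/-- Continuous approximations of the indicator function of `(1 / 4, ∞)`. -/
noncomputable def quarterStep (m : ℕ) (s : ℝ) : ℝ := min (m * max (s - 1 / 4) 0) 1

lemma continuous_quarterStep (m : ℕ) : Continuous (quarterStep m) := by
  unfold quarterStep; fun_prop

lemma quarterStep_nonneg (m : ℕ) (s : ℝ) : 0 ≤ quarterStep m s :=
  le_min (mul_nonneg (Nat.cast_nonneg m) (le_max_right _ _)) zero_le_one

lemma quarterStep_mono {m k : ℕ} (h : m ≤ k) (s : ℝ) : quarterStep m s ≤ quarterStep k s :=
  min_le_min (mul_le_mul_of_nonneg_right (by exact_mod_cast h) (le_max_right _ _)) le_rfl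

/-- Either step k has already reached 1, or s - 1/4 is at most 1/k and step m is at most m/k. In the
limit this makes the supremum of the steps idempotent. -/
lemma quarterStep_le_sq_add (m : ℕ) {k : ℕ} (hk : 0 < k) (s : ℝ) :
    quarterStep m s ≤ quarterStep k s * quarterStep k s + m / k := by
  have hk' : (0 : ℝ) < k := by exact_mod_cast hk
  have hm : (0 : ℝ) ≤ m := Nat.cast_nonneg m
  unfold quarterStep
  set d := max (s - 1 / 4) 0
  rcases le_total 1 (k * d) with h | h
  · rw [min_eq_right h]
    have := min_le_right (m * d) 1
    have : 0 ≤ (m : ℝ) / k := by positivity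
    linarith
  · have h1 : m * d ≤ m / k := by
      rw [le_div_iff₀ hk']; nlinarith
    have := min_le_left (m * d) 1
    nlinarith [mul_self_nonneg (min (k * d) 1)]

lemma quarterStep_le {s : ℝ} (hs : 0 ≤ s) (m : ℕ) : quarterStep m s ≤ 4 * s := by
  unfold quarterStep
  rcases le_total (s - 1 / 4) 0 with h | h
  · rw [max_eq_right h, mul_zero]; exact (min_le_left _ _).trans (by linarith)
  · exact (min_le_right _ _).trans (by linarith)

namespace IsFactorTrace

variable {A : Type*} [CStarAlgebra A] [PartialOrder A] [StarOrderedRing A] {τ : A →ₗ[ℂ] ℂ}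

open IsFaithfulTracialState

/-- A positive contraction dominates, up to a constant, its spectral projection for
`(1 / 4, ∞)`. -/
lemma exists_projection (h : IsFactorTrace τ) {a : A} (h0 : 0 ≤ a) (h1 : a ≤ 1) :
    ∃ e : A, IsStarProjection e ∧ e ≤ (4 : ℝ) • a ∧ (τ a).re - 1 / 4 ≤ (τ e).re := by
  have hg := continuous_quarterStep
  have has : IsSelfAdjoint a := IsSelfAdjoint.of_nonneg h0
  have hn := h.nontrivial
  set g : ℕ → A := fun m => cfc (quarterStep m) a with hgdef
  have hmono : Monotone g := fun m k hmk =>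
    cfc_mono (fun s _ => quarterStep_mono hmk s) (hg m).continuousOn (hg k).continuousOn
  have hg0 : ∀ m, 0 ≤ g m := fun m => cfc_nonneg fun s _ => quarterStep_nonneg m s
  have hg1 : ∀ m, g m ≤ 1 := fun m => cfc_le_one _ _ fun s _ => min_le_right _ _
  have hdir : DirectedOn (· ≤ ·) (Set.range g) := directedOn_range.mpr hmono.directed_le
  obtain ⟨e, he⟩ := h.exists_isLUB (Set.range g) (Set.range_nonempty g) hdir
    (by rintro _ ⟨m, rfl⟩; exact ⟨hg0 m, hg1 m⟩)
  have hle : ∀ m, g m ≤ e := fun m => he.1 ⟨m, rfl⟩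
  have he0 : 0 ≤ e := (hg0 0).trans (hle 0)
  have he1 : e ≤ 1 := he.2 (by rintro _ ⟨m, rfl⟩; exact hg1 m)
  have hlub := h.normal _ e (Set.range_nonempty g) hdir (by rintro _ ⟨m, rfl⟩; exact hg0 m) he
  -- Letting k → ∞ bounds each τ(g m) by τ(e²), and normality passes this to τ(e). Together with e²
  -- ≤ e and faithfulness it forces e² = e.
  have hee : (τ e).re ≤ (τ (e * e)).re := by
    refine hlub.2 ?_
    rintro _ ⟨_, ⟨m, rfl⟩, rfl⟩
    have key : ∀ k : ℕ, 0 < k → (τ (g m)).re ≤ (τ (e * e)).re + m / k := by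
      intro k hk
      have e1 : g m ≤ g k * g k + algebraMap ℝ A (m / k) := by
        rw [hgdef]
        simp only
        rw [← cfc_mul _ _ a (hg k).continuousOn (hg k).continuousOn, ← cfc_add_const _
          (fun s => quarterStep k s * quarterStep k s) a ((hg k).mul (hg k)).continuousOn]
        exact cfc_mono (fun s _ => quarterStep_le_sq_add m hk s) (hg m).continuousOn
          (((hg k).mul (hg k)).add continuous_const).continuousOn
      have e2 := h.re_mono e1
      have e3 : (τ (g k * g k)).re ≤ (τ (e * e)).re := by
        have p1 := h.re_mul_mono (hg0 k) (hle k)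
        have p2 := h.re_mul_mono he0 (hle k)
        rw [h.tracial] at p2
        exact p1.trans p2
      rw [Algebra.algebraMap_eq_smul_one, map_add, Complex.add_re, re_smul_real, h.map_one,
        Complex.one_re, mul_one] at e2
      linarith
    have hlim : Tendsto (fun k : ℕ => (τ (e * e)).re + m / k) atTop (𝓝 ((τ (e * e)).re + 0)) :=
      tendsto_const_nhds.add (tendsto_const_div_atTop_nhds_zero_nat _)
    rw [add_zero] at hlim
    exact ge_of_tendsto hlim (eventually_atTop.mpr ⟨1, fun k hk => key k hk⟩)
  have heq : e - e * e = 0 := by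
    refine h.eq_zero_of_re (sub_nonneg.mpr (mul_self_le_self he0 he1)) ?_
    rw [map_sub, Complex.sub_re]; linarith
  refine ⟨e, ⟨(sub_eq_zero.mp heq).symm, IsSelfAdjoint.of_nonneg he0⟩, he.2 ?_, ?_⟩
  · rintro _ ⟨m, rfl⟩
    have : (4 : ℝ) • a = cfc (fun s : ℝ => 4 * s) a := (cfc_const_mul_id 4 a).symm
    rw [this]
    exact cfc_mono (fun s hs => quarterStep_le (spectrum_nonneg_of_nonneg h0 hs) m)
      (hg m).continuousOn (by fun_prop)
  · have e1 : a ≤ g 1 + algebraMap ℝ A (1 / 4) := by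
      rw [hgdef]
      simp only
      rw [← cfc_add_const _ _ a (hg 1).continuousOn]
      conv_lhs => rw [← cfc_id' ℝ a]
      refine cfc_mono (fun s hs => ?_) (by fun_prop) ((hg 1).add continuous_const).continuousOn
      have hs1 : s ≤ 1 := by
        have := (spectrum.norm_le_norm_of_mem hs).trans (norm_le_one_of_nonneg h0 h1)
        exact (le_abs_self s).trans this
      unfold quarterStep
      rw [Nat.cast_one, one_mul, min_eq_left (max_le (by linarith) zero_le_one)]
      linarith [le_max_left (s - 1 / 4) 0]
    have e2 := h.re_mono e1
    rw [Algebra.algebraMap_eq_smul_one, map_add, Complex.add_re, re_smul_real, h.map_one,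
      Complex.one_re, mul_one] at e2
    linarith [h.re_mono (hle 1)]

/-- The spectral projection e for (1/4, ∞) satisfies e ≤ 4a and has trace at least 3/4 - 1/4, so
comparison carries a part of e onto 1 - e. -/
lemma exists_one_le (h : IsFactorTrace τ) {a : A} (h0 : 0 ≤ a) (h1 : a ≤ 1)
    (ha : 3 / 4 ≤ (τ a).re) :
    ∃ v : A, ‖v‖ ≤ 1 ∧ 1 ≤ (4 : ℝ) • (a + star v * a * v) := by
  obtain ⟨e, he, hea, hτ⟩ := h.exists_projection h0 h1
  obtain ⟨v, hv, hve⟩ := h.exists_contraction e he (by linarith)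
  refine ⟨v, hv, ?_⟩
  have h2 : star v * e * v ≤ star v * ((4 : ℝ) • a) * v := star_left_conjugate_le_conjugate hea v
  calc (1 : A) = e + star v * e * v := by rw [hve]; abel
    _ ≤ (4 : ℝ) • a + star v * ((4 : ℝ) • a) * v := add_le_add hea h2
    _ = _ := by rw [smul_add, mul_smul_comm, smul_mul_assoc]

/-- Conjugating the covering inequality by y bounds ‖y‖₂² by 4(‖ry‖₂² + ‖rvy‖₂²), and v can be moved
past y. With a = 1 - q, this shows that q cannot absorb y: adding r y² r gains trace comparable to
‖y‖₂². -/
lemma l2Norm_le_of_commute (h : IsFaithfulTracialState τ) {a r v y : A} (hr : IsSelfAdjoint r)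
    (hra : r * r = a) (hrn : ‖r‖ ≤ 1) (hv : ‖v‖ ≤ 1) (hav : 1 ≤ (4 : ℝ) • (a + star v * a * v))
    (hvy : l2Norm τ (v * y - y * v) ≤ 1 / 8 * l2Norm τ y) :
    l2Norm τ y ≤ 8 * l2Norm τ (r * y) := by
  have e1 : l2Norm τ y ^ 2 ≤ 4 * (l2Norm τ (r * y) ^ 2 + l2Norm τ (r * (v * y)) ^ 2) := by
    have := h.re_mono (star_left_conjugate_le_conjugate hav y)
    rw [mul_one, ← h.l2Norm_sq] at this
    refine this.trans_eq ?_
    rw [mul_smul_comm, smul_mul_assoc, re_smul_real, h.l2Norm_sq, h.l2Norm_sq, ← Complex.add_re,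
      ← map_add, ← hra]
    simp only [star_mul, hr.star_eq]
    congr 3
    noncomm_ring
  have e2 : l2Norm τ (r * (v * y)) ≤ l2Norm τ (r * y) + 1 / 8 * l2Norm τ y := by
    have e : r * (v * y) = r * y * v + r * (v * y - y * v) := by noncomm_ring
    rw [e]
    refine (h.l2Norm_add_le _ _).trans (add_le_add (h.l2Norm_mul_le_of_norm_le_one' hv _) ?_)
    exact (h.l2Norm_mul_le_of_norm_le_one hrn _).trans hvy
  have p1 := l2Norm_nonneg (τ := τ) (r * y)
  have p2 := l2Norm_nonneg (τ := τ) (r * (v * y))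
  have p3 := l2Norm_nonneg (τ := τ) y
  by_contra hc
  push Not at hc
  nlinarith

lemma isLUB_image_starAlgEquiv (θ : A ≃⋆ₐ[ℂ] A) {D : Set A} {q : A} (hq : IsLUB D q) :
    IsLUB (θ '' D) (θ q) :=
  (OrderIsoClass.toOrderIso θ).isLUB_image'.mpr hq

/-- The positive contractions of trace at most `1 / 4` which are almost projections and almost
invariant under the given automorphisms, relative to their trace. -/
def almostInvariant (τ : A →ₗ[ℂ] ℂ) {ι : Type*} (θ : ι → A ≃⋆ₐ[ℂ] A) (ε : ℝ) : Set A :=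
  {q | 0 ≤ q ∧ q ≤ 1 ∧ (τ q).re ≤ 1 / 4 ∧ (τ q).re - l2Norm τ q ^ 2 ≤ ε * (τ q).re ∧
    ∀ i, l2Norm τ (θ i q - q) ^ 2 ≤ ε * (τ q).re}

/-- Along a chain, normality makes suprema 2-norm limits, because ‖q - d‖₂² ≤ τ(q - d) for 0 ≤ q - d
≤ 1. All the defining conditions survive such limits. -/
lemma exists_upperBound_almostInvariant (h : IsFactorTrace τ) {ι : Type*} (θ : ι → A ≃⋆ₐ[ℂ] A)
    {ε : ℝ} (hε : 0 < ε) {c : Set A} (hc : c ⊆ almostInvariant τ θ ε)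
    (hchain : IsChain (· ≤ ·) c) : ∃ q ∈ almostInvariant τ θ ε, ∀ z ∈ c, z ≤ q := by
  rcases c.eq_empty_or_nonempty with rfl | hne
  · refine ⟨0, ⟨le_rfl, zero_le_one, ?_, ?_, fun i => ?_⟩, by simp⟩ <;> simp [l2Norm_zero]
  have hdir : DirectedOn (· ≤ ·) c := hchain.directedOn
  obtain ⟨q, hq⟩ := h.exists_isLUB c hne hdir fun d hd => ⟨(hc hd).1, (hc hd).2.1⟩
  have hq0 : 0 ≤ q := hne.elim fun d hd => (hc hd).1.trans (hq.1 hd)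
  have hq1 : q ≤ 1 := hq.2 fun d hd => (hc hd).2.1
  have hlub := h.normal c q hne hdir (fun d hd => (hc hd).1) hq
  have hτle : ∀ d ∈ c, (τ d).re ≤ (τ q).re := fun d hd => h.re_mono (hq.1 hd)
  have happrox : ∀ κ > 0, ∃ d ∈ c, (τ q).re - κ < (τ d).re := by
    intro κ hκ
    obtain ⟨_, ⟨d, hd, rfl⟩, h1, _⟩ := hlub.exists_between (sub_lt_self _ hκ)
    exact ⟨d, hd, h1⟩
  refine ⟨q, ⟨hq0, hq1, ?_, ?_, fun i => ?_⟩, fun z hz => hq.1 hz⟩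
  · exact hlub.2 (by rintro _ ⟨d, hd, rfl⟩; exact (hc hd).2.2.1)
  · refine le_of_forall_pos_le_add fun κ hκ => ?_
    obtain ⟨d, hd, hdκ⟩ := happrox κ hκ
    obtain ⟨hd0, hd1, -, hdp, -⟩ := hc hd
    have e3 : l2Norm τ d ^ 2 ≤ l2Norm τ q ^ 2 := by
      rw [h.l2Norm_sq_of_isSelfAdjoint (IsSelfAdjoint.of_nonneg hd0),
        h.l2Norm_sq_of_isSelfAdjoint (IsSelfAdjoint.of_nonneg hq0)]
      have p1 := h.re_mul_mono hd0 (hq.1 hd)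
      have p2 := h.re_mul_mono hq0 (hq.1 hd)
      rw [h.tracial] at p2
      exact p1.trans p2
    have := mul_le_mul_of_nonneg_left (hτle d hd) hε.le
    linarith
  · have hθm : ∀ {x y : A}, x ≤ y → θ i x ≤ θ i y := fun hxy => OrderHomClass.mono (θ i) hxy
    have hθ0 : ∀ {x : A}, 0 ≤ x → 0 ≤ θ i x := fun hx => by simpa using hθm hx
    -- The automorphism is not assumed to preserve τ, so normality is applied separately to the
    -- image of the chain.
    have hlubθ := h.normal (θ i '' c) (θ i q) (hne.image _)
      (by
        rintro _ ⟨x, hx, rfl⟩ _ ⟨y, hy, rfl⟩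
        obtain ⟨z, hz, hxz, hyz⟩ := hdir x hx y hy
        exact ⟨_, ⟨z, hz, rfl⟩, hθm hxz, hθm hyz⟩)
      (by rintro _ ⟨x, hx, rfl⟩; exact hθ0 (hc hx).1) (isLUB_image_starAlgEquiv (θ i) hq)
    have happroxθ : ∀ κ > 0, ∃ d ∈ c, (τ (θ i q)).re - κ < (τ (θ i d)).re := by
      intro κ hκ
      obtain ⟨_, ⟨_, ⟨d, hd, rfl⟩, rfl⟩, h1, _⟩ := hlubθ.exists_between (sub_lt_self _ hκ)
      exact ⟨d, hd, h1⟩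
    have hεq : 0 ≤ ε * (τ q).re := mul_nonneg hε.le (h.re_nonneg hq0)
    have key : l2Norm τ (θ i q - q) ≤ √(ε * (τ q).re) := by
      refine le_of_forall_pos_le_add fun κ hκ => ?_
      have hκ2 : 0 < (κ / 2) ^ 2 := by positivity
      obtain ⟨d₁, hd₁, h₁⟩ := happrox _ hκ2
      obtain ⟨d₂, hd₂, h₂⟩ := happroxθ _ hκ2
      obtain ⟨d, hd, hd₁d, hd₂d⟩ := hdir d₁ hd₁ d₂ hd₂
      obtain ⟨hd0, hd1, -, -, hdi⟩ := hc hd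
      have s1 : 0 ≤ q - d := sub_nonneg.mpr (hq.1 hd)
      have s2 : q - d ≤ 1 := (sub_le_self q hd0).trans hq1
      have a1 : l2Norm τ (q - d) ≤ κ / 2 := by
        refine (pow_le_pow_iff_left₀ (l2Norm_nonneg _) (by positivity) two_ne_zero).mp ?_
        have := h.l2Norm_sq_le_re s1 s2
        rw [map_sub, Complex.sub_re] at this
        linarith [h.re_mono hd₁d]
      have a2 : l2Norm τ (θ i (q - d)) ≤ κ / 2 := by
        refine (pow_le_pow_iff_left₀ (l2Norm_nonneg _) (by positivity) two_ne_zero).mp ?_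
        have := h.l2Norm_sq_le_re (hθ0 s1) ((hθm s2).trans_eq (θ i).apply_one)
        rw [map_sub, map_sub, Complex.sub_re] at this
        rw [map_sub]
        linarith [h.re_mono (hθm hd₂d)]
      have a3 : l2Norm τ (θ i d - d) ≤ √(ε * (τ q).re) := by
        refine Real.le_sqrt_of_sq_le ((hdi i).trans ?_)
        exact mul_le_mul_of_nonneg_left (hτle d hd) hε.le
      have e : θ i q - q = (θ i d - d) + θ i (q - d) - (q - d) := by rw [map_sub]; abel
      rw [e]
      have b1 := h.l2Norm_sub_le ((θ i d - d) + θ i (q - d)) (q - d)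
      have b2 := h.l2Norm_add_le (θ i d - d) (θ i (q - d))
      linarith
    have := pow_le_pow_left₀ (l2Norm_nonneg _) key 2
    rwa [Real.sq_sqrt hεq] at this

/-- Patching: if there are nonzero almost projections of arbitrarily small trace which are
relatively almost central and almost invariant, then there are such elements with trace
between `1 / 8` and `1 / 4`. -/
theorem exists_almostInvariant (h : IsFactorTrace τ) {ι : Type*} [Finite ι]
    (θ : ι → A ≃⋆ₐ[ℂ] A) {ε : ℝ} (hε : 0 < ε)
    (hsmall : ∀ (F : Set A) (_ : F.Finite) (δ : ℝ), 0 < δ → ∃ y : A, 0 ≤ y ∧ y ≤ 1 ∧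
      0 < l2Norm τ y ∧ (∀ a ∈ F, l2Norm τ (a * y - y * a) ≤ δ * l2Norm τ y) ∧
      (∀ i, l2Norm τ (θ i y - y) ≤ δ * l2Norm τ y) ∧
      l2Norm τ y ^ 2 - l2Norm τ (y * y) ^ 2 ≤ δ * l2Norm τ y ^ 2 ∧ l2Norm τ y ^ 2 ≤ δ) :
    ∃ q ∈ almostInvariant τ θ ε, 1 / 8 ≤ (τ q).re := by
  obtain ⟨q, hqmax⟩ := zorn_le₀ (almostInvariant τ θ ε) fun c hc hchain =>
    h.exists_upperBound_almostInvariant θ hε hc hchain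
  refine ⟨q, hqmax.1, ?_⟩
  by_contra hlt
  push Not at hlt
  obtain ⟨hq0, hq1, -, hqp, hqi⟩ := hqmax.1
  have ha0 : 0 ≤ 1 - q := sub_nonneg.mpr hq1
  have ha1 : 1 - q ≤ 1 := sub_le_self 1 hq0
  obtain ⟨v, hv, hav⟩ := h.exists_one_le ha0 ha1 (by
    rw [map_sub, Complex.sub_re, h.map_one, Complex.one_re]; linarith)
  set r := CFC.sqrt (1 - q) with hrdef
  have hrr : r * r = 1 - q := CFC.sqrt_mul_sqrt_self (1 - q) ha0
  have hrs : IsSelfAdjoint r := IsSelfAdjoint.of_nonneg (CFC.sqrt_nonneg _)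
  have hrn := norm_le_one_of_mul_self hrs hrr hq0 hq1
  -- The bound 1/8 is the commutation tolerance of `l2Norm_le_of_commute` and keeps the new trace
  -- below 1/8 + 1/8. Since ‖y‖₂² ≤ 64‖ry‖₂², the displacement error 150δ‖y‖₂² is at most ε times
  -- the trace gained, as 150 · 64 ≤ 10000.
  set δ : ℝ := min (1 / 8) (ε / 10000) with hδ
  have hδ0 : 0 < δ := lt_min (by norm_num) (by positivity)
  have hδ8 : δ ≤ 1 / 8 := min_le_left _ _
  have hδε : δ ≤ ε / 10000 := min_le_right _ _
  obtain ⟨y, hy0, hy1, hyn, hyF, hyθ, hyp, hyδ⟩ := hsmall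
    ({r, v} ∪ Set.range fun i => θ i r) (((Set.finite_singleton v).insert r).union
      (Set.finite_range _)) δ hδ0
  have hry := hyF r (by simp)
  have hvy := hyF v (by simp)
  have hys : IsSelfAdjoint y := IsSelfAdjoint.of_nonneg hy0
  have hlow := l2Norm_le_of_commute h.toIsFaithfulTracialState hrs hrr hrn hv hav
    (hvy.trans (mul_le_mul_of_nonneg_right hδ8 hyn.le))
  have hτ := h.re_extension (q := q) hrs hys
  have hdef := h.extension_defect (by linarith) hq0 hq1 hrs hrr hy0 hy1 hry hyp
  have hdis := fun i => h.extension_displacement (θ i) (by linarith) hq0 hq1 hrs hrr hy0 hy1 hry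
    (hyF (θ i r) (by simp)) (hyθ i)
  have hyy0 : 0 ≤ y * y := by simpa [hys.star_eq] using star_mul_self_nonneg y
  have hyy1 : y * y ≤ 1 := (mul_self_le_self hy0 hy1).trans hy1
  set q' := q + r * (y * y) * r with hq'
  have hqq' : q ≤ q' := le_add_of_nonneg_right (by
    simpa [hrs.star_eq] using star_left_conjugate_nonneg hyy0 r)
  have hlow2 : l2Norm τ y ^ 2 ≤ 64 * l2Norm τ (r * y) ^ 2 := by
    have := pow_le_pow_left₀ hyn.le hlow 2
    linarith
  have hup : l2Norm τ (r * y) ^ 2 ≤ 1 / 8 :=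
    (pow_le_pow_left₀ (l2Norm_nonneg _) (h.l2Norm_mul_le_of_norm_le_one hrn y) 2).trans
      (hyδ.trans hδ8)
  have hy2 : 0 < l2Norm τ y ^ 2 := by positivity
  have hgain : 150 * δ * l2Norm τ y ^ 2 ≤ ε * l2Norm τ (r * y) ^ 2 := by
    have p1 := mul_le_mul_of_nonneg_right hδε hy2.le
    nlinarith
  have hmem : q' ∈ almostInvariant τ θ ε := by
    refine ⟨hq0.trans hqq', ?_, ?_, ?_, fun i => ?_⟩
    · have : r * (y * y) * r ≤ r * 1 * r := by
        simpa [hrs.star_eq] using star_left_conjugate_le_conjugate hyy1 r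
      calc q' ≤ q + r * 1 * r := add_le_add_right this q
        _ = 1 := by rw [mul_one, hrr]; abel
    · rw [hτ]; linarith
    · rw [hτ] at hdef ⊢; nlinarith
    · rw [hτ]; linarith [hdis i, hqi i]
  have h1 := h.re_mono (hqmax.2 hmem hqq')
  rw [hτ] at h1
  linarith

end IsFactorTrace

/-! ### Normalised witnesses and clipping -/

/-- Truncation of a real number to the interval `[-C, C]`. -/
noncomputable def clip (C s : ℝ) : ℝ := max (-C) (min s C)

lemma continuous_clip (C : ℝ) : Continuous (clip C) := by unfold clip; fun_prop

lemma abs_clip_le {C : ℝ} (hC : 0 ≤ C) (s : ℝ) : |clip C s| ≤ C :=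
  abs_le.mpr ⟨le_max_left _ _, max_le (by linarith) (min_le_right _ _)⟩

lemma sq_clip_sub_clip_le (C s t : ℝ) : (clip C s - clip C t) ^ 2 ≤ (s - t) ^ 2 := by
  rw [← sq_abs (s - t), ← sq_abs (clip C s - clip C t)]
  refine pow_le_pow_left₀ (abs_nonneg _) ?_ 2
  refine (abs_max_sub_max_le_max _ _ _ _).trans ?_
  rw [sub_self, abs_zero]
  refine max_le (abs_nonneg _) ((abs_min_sub_min_le_max _ _ _ _).trans ?_)
  rw [sub_self, abs_zero]
  exact max_le le_rfl (abs_nonneg _)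

lemma abs_clip {C : ℝ} (hC : 0 ≤ C) (s : ℝ) : |clip C s| = min |s| C := by
  unfold clip
  rcases le_total s (-C) with h | h
  · have hs : |s| = -s := abs_of_nonpos (by linarith)
    rw [hs, min_eq_left (by linarith : s ≤ C), max_eq_left h, abs_neg, abs_of_nonneg hC,
      min_eq_right (by linarith)]
  · rcases le_total s C with h' | h'
    · rw [min_eq_left h', max_eq_right h, min_eq_left (abs_le.mpr ⟨h, h'⟩)]
    · rw [min_eq_right h', max_eq_right (by linarith), abs_of_nonneg hC,
        min_eq_right (h'.trans (le_abs_self s))]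

/-- Where clipping acts, |s| ≥ C, so the change, at most |s|, is at most s²/C. -/
lemma abs_sub_clip_le {C : ℝ} (hC : 0 < C) (s : ℝ) : |clip C s - s| ≤ C⁻¹ * (s * s) := by
  rw [inv_mul_eq_div, le_div_iff₀ hC]
  unfold clip
  rcases le_total s (-C) with h | h
  · rw [min_eq_left (by linarith : s ≤ C), max_eq_left h, abs_of_nonneg (by linarith)]
    nlinarith
  · rcases le_total s C with h' | h'
    · rw [min_eq_left h', max_eq_right h, sub_self, abs_zero, zero_mul]
      exact mul_self_nonneg s
    · rw [min_eq_right h', max_eq_right (by linarith), abs_of_nonpos (by linarith)]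
      nlinarith

namespace IsFaithfulTracialState

variable {A : Type*} [CStarAlgebra A] [PartialOrder A] [StarOrderedRing A] {τ : A →ₗ[ℂ] ℂ}

lemma map_of_isSelfAdjoint (h : IsFaithfulTracialState τ) {x : A} (hx : IsSelfAdjoint x) :
    τ x = ((τ x).re : ℂ) := by
  have := h.re_star x
  rw [hx.star_eq] at this
  exact (Complex.conj_eq_iff_re.mp this.symm).symm

lemma l2Norm_algebraMap (h : IsFaithfulTracialState τ) (c : ℂ) : l2Norm τ (c • (1 : A)) = ‖c‖ := by
  rw [h.l2Norm_smul, h.l2Norm_one, mul_one]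

lemma starAlgEquiv_cfc (θ : A ≃⋆ₐ[ℂ] A) {φ : ℝ → ℝ} (hφ : Continuous φ) {x : A}
    (hx : IsSelfAdjoint x) : θ (cfc φ x) = cfc φ (θ x) := by
  have hcont : Continuous θ :=
    AddMonoidHomClass.continuous_of_bound θ 1 fun y => by
      simpa using NonUnitalStarAlgHom.norm_apply_le θ y
  let θ' : A →⋆ₐ[ℂ] A :=
    { toFun := θ
      map_one' := θ.apply_one
      map_mul' := map_mul θ
      map_zero' := map_zero θ
      map_add' := map_add θ
      commutes' := fun c => by
        rw [Algebra.algebraMap_eq_smul_one, map_smul, θ.apply_one]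
      map_star' := map_star θ }
  exact StarAlgHomClass.map_cfc θ' φ x hφ.continuousOn hcont hx (hx.map θ)

/-- A self-adjoint, centered and normalised witness for the absence of a spectral gap. -/
lemma exists_isSelfAdjoint_of_lt (h : IsFaithfulTracialState τ) {Λ : Type*} (T : Λ → A ≃⋆ₐ[ℂ] A)
    {J : Finset Λ} {δ : ℝ} (hδ : 0 < δ) {x : A}
    (hx : 2 / δ * ∑ j ∈ J, l2Norm τ (T j x - x) < l2Norm τ (x - τ x • 1)) :
    ∃ w : A, IsSelfAdjoint w ∧ τ w = 0 ∧ l2Norm τ w = 1 ∧ ∀ j ∈ J, l2Norm τ (T j w - w) ≤ δ := by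
  set x₀ := x - τ x • (1 : A) with hx₀
  have hτ₀ : τ x₀ = 0 := by simp [hx₀, h.map_one]
  have hθ₀ : ∀ j, T j x₀ - x₀ = T j x - x := fun j => by
    rw [hx₀, map_sub, map_smul, (T j).apply_one]; abel
  clear_value x₀
  set N := l2Norm τ x₀
  have hsum : ∀ j ∈ J, l2Norm τ (T j x - x) ≤ δ * (N / 2) := fun j hj => by
    have h1 := Finset.single_le_sum (f := fun j => l2Norm τ (T j x - x))
      (fun i _ => l2Norm_nonneg _) hj
    rw [div_mul_eq_mul_div, div_lt_iff₀ hδ] at hx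
    linarith
  have hN : 0 < N := lt_of_le_of_lt (mul_nonneg (by positivity)
    (Finset.sum_nonneg fun j _ => l2Norm_nonneg _)) hx
  -- α = 1/2 gives the real part of x₀ and α = -i/2 the imaginary part. One of them has 2-norm at
  -- least N/2, which is paid for by the 2 in `hx`.
  have key : ∀ α : ℂ, ‖α‖ = 1 / 2 → N / 2 ≤ l2Norm τ (α • x₀ + star (α • x₀)) →
      ∃ w : A, IsSelfAdjoint w ∧ τ w = 0 ∧ l2Norm τ w = 1 ∧
        ∀ j ∈ J, l2Norm τ (T j w - w) ≤ δ := by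
    intro α hα hle
    set w₀ := α • x₀ + star (α • x₀) with hw₀
    set M := l2Norm τ w₀
    have hM : 0 < M := by linarith
    have hsa : IsSelfAdjoint w₀ := by
      rw [IsSelfAdjoint, hw₀, star_add, star_star, add_comm]
    have hM' : ‖((M⁻¹ : ℝ) : ℂ)‖ = M⁻¹ := by
      rw [Complex.norm_real, Real.norm_of_nonneg (by positivity)]
    refine ⟨((M⁻¹ : ℝ) : ℂ) • w₀, ?_, ?_, ?_, fun j hj => ?_⟩
    · rw [Complex.coe_smul]
      exact IsSelfAdjoint.smul (IsSelfAdjoint.all _) hsa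
    · rw [map_smul, hw₀, map_add, h.re_star, map_smul, hτ₀]; simp
    · rw [h.l2Norm_smul, hM']; exact inv_mul_cancel₀ hM.ne'
    · rw [map_smul, ← smul_sub, h.l2Norm_smul, hM', inv_mul_le_iff₀ hM]
      have e : T j w₀ - w₀ = α • (T j x₀ - x₀) + star (α • (T j x₀ - x₀)) := by
        rw [hw₀, map_add, map_star, map_smul, smul_sub, star_sub]; abel
      rw [e, hθ₀]
      have b := h.l2Norm_add_le (α • (T j x - x)) (star (α • (T j x - x)))
      rw [h.l2Norm_star, h.l2Norm_smul, hα] at b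
      have := hsum j hj
      have := mul_le_mul_of_nonneg_left hle hδ.le
      linarith
  rcases le_or_gt (N / 2) (l2Norm τ ((1 / 2 : ℂ) • x₀ + star ((1 / 2 : ℂ) • x₀))) with hc | hc
  · exact key _ (by norm_num) hc
  · refine key (-(Complex.I / 2)) (by simp) ?_
    have e : x₀ = ((1 / 2 : ℂ) • x₀ + star ((1 / 2 : ℂ) • x₀)) +
        Complex.I • (-(Complex.I / 2) • x₀ + star (-(Complex.I / 2) • x₀)) := by
      simp only [star_smul, smul_add, smul_smul]
      have e1 : Complex.I * -(Complex.I / 2) = 1 / 2 := by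
        linear_combination (-1 / 2 : ℂ) * Complex.I_mul_I
      have e2 : Complex.I * star (-(Complex.I / 2)) = -(1 / 2) := by
        simp only [Complex.star_def, map_neg, map_div₀, Complex.conj_I, Complex.conj_ofNat]
        linear_combination (1 / 2 : ℂ) * Complex.I_mul_I
      have e3 : star (1 / 2 : ℂ) = 1 / 2 := by simp
      rw [e1, e2, e3, add_add_add_comm, ← add_smul, ← add_smul]
      norm_num
    have b := h.l2Norm_add_le ((1 / 2 : ℂ) • x₀ + star ((1 / 2 : ℂ) • x₀))
      (Complex.I • (-(Complex.I / 2) • x₀ + star (-(Complex.I / 2) • x₀)))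
    rw [← e, h.l2Norm_smul, Complex.norm_I, one_mul] at b
    change N ≤ _ at b
    linarith

/-- A self-adjoint element of `2`-norm one and trace zero whose truncation is almost scalar has most
of its mass at large heights. -/
lemma l2Norm_trunc_le (h : IsFaithfulTracialState τ) {x : A} (hx : IsSelfAdjoint x)
    (hτ : τ x = 0) (hx1 : l2Norm τ x = 1) {C ε : ℝ} (hC : 1 ≤ C)
    (hε : l2Norm τ (cfc (clip C) x - τ (cfc (clip C) x) • 1) ≤ ε) :
    l2Norm τ (cfc (fun s : ℝ => min |s| 1) x) ≤ ε + C⁻¹ := by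
  have hC0 : 0 < C := by linarith
  have hcl := continuous_clip C
  set b := cfc (clip C) x with hb
  have hbs : IsSelfAdjoint b := cfc_predicate _ _
  have hx2 : (τ (cfc (fun s : ℝ => C⁻¹ * (s * s)) x)).re = C⁻¹ := by
    rw [cfc_const_mul _ _ x (by fun_prop), re_smul_real, ← h.l2Norm_cfc_sq continuous_id' x,
      cfc_id' ℝ x, hx1]
    norm_num
  have hsub : (τ (cfc (fun s => clip C s - s) x)).re = (τ b).re := by
    rw [cfc_sub _ _ x hcl.continuousOn (by fun_prop), cfc_id' ℝ x, map_sub, hτ, sub_zero]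
  -- As τ(x) = 0, τ(b) is the trace of the clipping error, at most C⁻¹τ(x²) = C⁻¹.
  have hτb : ‖τ b‖ ≤ C⁻¹ := by
    rw [h.map_of_isSelfAdjoint hbs, Complex.norm_real, Real.norm_eq_abs, ← hsub, abs_le]
    constructor
    · have := h.re_cfc_mono (x := x) (φ := fun s => (-1) * (C⁻¹ * (s * s)))
        (ψ := fun s => clip C s - s) (by fun_prop) (by fun_prop)
        fun s _ => by have := (abs_le.mp (abs_sub_clip_le hC0 s)).1; linarith
      rw [cfc_const_mul _ _ x (by fun_prop), re_smul_real, hx2] at this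
      linarith
    · have := h.re_cfc_mono (x := x) (φ := fun s => clip C s - s)
        (ψ := fun s => C⁻¹ * (s * s)) (by fun_prop) (by fun_prop)
        fun s _ => (abs_le.mp (abs_sub_clip_le hC0 s)).2
      rwa [hx2] at this
  have hbn : l2Norm τ b ≤ ε + C⁻¹ := by
    have := h.l2Norm_add_le (b - τ b • 1) (τ b • 1)
    rw [sub_add_cancel, h.l2Norm_algebraMap] at this
    linarith
  refine le_trans ?_ hbn
  refine (pow_le_pow_iff_left₀ (l2Norm_nonneg _) (l2Norm_nonneg _) two_ne_zero).mp ?_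
  rw [h.l2Norm_cfc_sq (by fun_prop), h.l2Norm_cfc_sq hcl]
  refine h.re_cfc_mono (by fun_prop) (by fun_prop) fun s _ => ?_
  rw [← abs_mul_abs_self (clip C s), abs_clip hC0.le]
  have h0 : 0 ≤ min |s| 1 := le_min (abs_nonneg s) zero_le_one
  have h1 : min |s| 1 ≤ min |s| C := min_le_min le_rfl hC
  exact mul_le_mul h1 h1 h0 (h0.trans h1)

/-- Pointwise p² - p⁴ = (p - p²)·p(1 + p) ≤ 2(p - p²) on [0, 1]. This converts the defect delivered
by `exists_cutoff` into the one needed for patching. -/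
lemma l2Norm_cfc_defect (h : IsFaithfulTracialState τ) {φ : ℝ → ℝ} (hφ : Continuous φ)
    (h01 : ∀ s, 0 ≤ φ s ∧ φ s ≤ 1) (x : A) :
    l2Norm τ (cfc φ x) ^ 2 - l2Norm τ (cfc φ x * cfc φ x) ^ 2 ≤
      2 * ((τ (cfc φ x)).re - l2Norm τ (cfc φ x) ^ 2) := by
  have hφ2 : Continuous fun s => φ s * φ s := hφ.mul hφ
  rw [← cfc_mul φ φ x hφ.continuousOn hφ.continuousOn, h.l2Norm_cfc_sq hφ, h.l2Norm_cfc_sq hφ2]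
  have := h.re_cfc_mono (x := x) (φ := fun s => φ s * φ s + 2 * (φ s * φ s))
    (ψ := fun s => 2 * φ s + φ s * φ s * (φ s * φ s)) (by fun_prop) (by fun_prop) fun s _ => by
      obtain ⟨h0, h1⟩ := h01 s
      nlinarith [mul_nonneg (mul_nonneg h0 (sub_nonneg.mpr h1)) (sub_nonneg.mpr h1),
        mul_nonneg (mul_nonneg h0 h0) (mul_nonneg (sub_nonneg.mpr h1) (sub_nonneg.mpr h1)),
        mul_nonneg h0 (sub_nonneg.mpr h1)]
  rw [cfc_add x _ _ hφ2.continuousOn (by fun_prop), cfc_add x _ _ (by fun_prop) (by fun_prop),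
    cfc_const_mul _ _ x hφ2.continuousOn, cfc_const_mul _ _ x hφ.continuousOn, map_add, map_add,
    Complex.add_re, Complex.add_re, re_smul_real, re_smul_real] at this
  linarith

end IsFaithfulTracialState

/-! ### From almost fixed elements to a spectral gap -/

namespace IsFaithfulTracialState

variable {A : Type*} [CStarAlgebra A] [PartialOrder A] [StarOrderedRing A] {τ : A →ₗ[ℂ] ℂ}
  {Λ : Type*} (T : Λ → A ≃⋆ₐ[ℂ] A)

/-- Bounded elements which are almost fixed by the automorphisms `T j` are almost scalar. -/
def AlmostFixedAreScalar (τ : A →ₗ[ℂ] ℂ) : Prop :=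
  ∀ ε > 0, ∀ C : ℝ, ∃ J : Finset Λ, ∃ δ > 0, ∀ x : A, ‖x‖ ≤ C →
    (∀ j ∈ J, l2Norm τ (T j x - x) ≤ δ) → l2Norm τ (x - τ x • 1) ≤ ε

/-- Commutators are controlled by the displacements of the automorphisms `T j`. -/
def ControlsCommutators (τ : A →ₗ[ℂ] ℂ) : Prop :=
  ∀ a : A, ∃ J : Finset Λ, ∃ C : ℝ, ∀ y : A,
    l2Norm τ (a * y - y * a) ≤ C * ∑ j ∈ J, l2Norm τ (T j y - y)

variable {T}

lemma exists_small_almostInvariant [DecidableEq Λ] (h : IsFaithfulTracialState τ)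
    (hT : AlmostFixedAreScalar T τ)
    (hgap : ∀ (J : Finset Λ) (κ : ℝ), 0 < κ →
      ∃ x : A, κ * ∑ j ∈ J, l2Norm τ (T j x - x) < l2Norm τ (x - τ x • 1))
    (J : Finset Λ) {δ : ℝ} (hδ : 0 < δ) :
    ∃ y : A, 0 ≤ y ∧ y ≤ 1 ∧ 0 < l2Norm τ y ∧ (∀ j ∈ J, l2Norm τ (T j y - y) ≤ δ * l2Norm τ y) ∧
      l2Norm τ y ^ 2 - l2Norm τ (y * y) ^ 2 ≤ δ * l2Norm τ y ^ 2 ∧ l2Norm τ y ^ 2 ≤ δ := by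
  -- δ² because the cutoff bounds squared displacements, δ/2 because of the factor 2 in
  -- `l2Norm_cfc_defect`.
  set δ₁ : ℝ := min (δ ^ 2) (δ / 2) with hδ₁
  have hδ₁0 : 0 < δ₁ := lt_min (by positivity) (by positivity)
  have hδ₁s : δ₁ ≤ δ ^ 2 := min_le_left _ _
  have hδ₁h : δ₁ ≤ δ / 2 := min_le_right _ _
  obtain ⟨ε₀, hε₀, hcut⟩ := h.exists_cutoff J hδ₁0
  set ε : ℝ := √(min ε₀ 1) with hε
  have hmin : 0 < min ε₀ 1 := lt_min hε₀ one_pos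
  have hε0 : 0 < ε := Real.sqrt_pos.mpr hmin
  have hε1 : ε ≤ 1 := Real.sqrt_le_one.mpr (min_le_right _ _)
  have hεsq : ε ^ 2 ≤ ε₀ := by rw [hε, Real.sq_sqrt hmin.le]; exact min_le_left _ _
  -- Clipping at 2/ε costs (2/ε)⁻¹ = ε/2, which with the tolerance ε/2 leaves truncated 2-norm at
  -- most ε; ε ≤ 1 keeps the clipping height at least 1.
  obtain ⟨J', δ', hδ', hJ'⟩ := hT (ε / 2) (half_pos hε0) (2 / ε)
  obtain ⟨x₀, hx₀⟩ := hgap (J ∪ J') (2 / min δ' ε) (by have := lt_min hδ' hε0; positivity)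
  obtain ⟨x, hxs, hxτ, hx1, hxT⟩ := h.exists_isSelfAdjoint_of_lt T (lt_min hδ' hε0) hx₀
  have hC1 : 1 ≤ 2 / ε := by rw [le_div_iff₀ hε0]; linarith
  have hclip : l2Norm τ (cfc (clip (2 / ε)) x - τ (cfc (clip (2 / ε)) x) • 1) ≤ ε / 2 := by
    refine hJ' _ (norm_cfc_le (by linarith) fun s _ => abs_clip_le (by linarith) s) fun j hj => ?_
    rw [starAlgEquiv_cfc (T j) (continuous_clip _) hxs]
    have h1 := h.sum_l2Norm_cfc_sub_sq_le (Finset.univ : Finset Unit)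
      (f := fun _ => clip (2 / ε)) (fun _ => continuous_clip _)
      (fun s t => by simpa using sq_clip_sub_clip_le _ s t) (hxs.map (T j)) hxs
    rw [Finset.univ_unique, Finset.sum_singleton,
      pow_le_pow_iff_left₀ (l2Norm_nonneg _) (l2Norm_nonneg _) two_ne_zero] at h1
    exact h1.trans ((hxT j (Finset.mem_union_right _ hj)).trans (min_le_left _ _))
  have htr := h.l2Norm_trunc_le hxs hxτ hx1 hC1 hclip
  rw [inv_div, add_halves] at htr
  obtain ⟨φ, hφ, hφ01, hpos, hφT, hφd, hφs⟩ := hcut x (fun j => T j x) hxs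
    (fun j => hxs.map (T j)) hx1 ((pow_le_pow_left₀ (l2Norm_nonneg _) htr 2).trans hεsq)
    (fun j => ((pow_le_pow_left₀ (l2Norm_nonneg _)
      ((hxT j (Finset.mem_union_left _ j.2)).trans (min_le_right _ _)) 2).trans hεsq))
  refine ⟨cfc φ x, cfc_nonneg fun s _ => (hφ01 s).1, cfc_le_one _ _ fun s _ => (hφ01 s).2, hpos,
    fun j hj => ?_, ?_, by linarith⟩
  · rw [starAlgEquiv_cfc (T j) hφ hxs]
    refine (pow_le_pow_iff_left₀ (l2Norm_nonneg _) (by positivity) two_ne_zero).mp ?_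
    rw [mul_pow]
    exact (hφT ⟨j, hj⟩).trans (mul_le_mul_of_nonneg_right hδ₁s (sq_nonneg _))
  · have := h.l2Norm_cfc_defect hφ hφ01 x
    have h2 := mul_le_mul_of_nonneg_right hδ₁h (sq_nonneg (l2Norm τ (cfc φ x)))
    linarith

lemma ControlsCommutators.finite [DecidableEq Λ] (hT : ControlsCommutators T τ) {F : Set A}
    (hF : F.Finite) {δ : ℝ} (hδ : 0 < δ) :
    ∃ J : Finset Λ, ∃ δ' > 0, ∀ (y : A) (n : ℝ), 0 ≤ n →
      (∀ j ∈ J, l2Norm τ (T j y - y) ≤ δ' * n) → ∀ a ∈ F, l2Norm τ (a * y - y * a) ≤ δ * n := by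
  induction F, hF using Set.Finite.induction_on with
  | empty => exact ⟨∅, 1, one_pos, by simp⟩
  | @insert a F _ _ ih =>
    obtain ⟨J, δ', hδ', hJ⟩ := ih
    obtain ⟨J₁, C, hC⟩ := hT a
    -- The added 1 keeps c positive even if C = 0 or `J₁` is empty.
    set c : ℝ := |C| * J₁.card + 1 with hc
    have hc0 : 0 < c := by positivity
    refine ⟨J ∪ J₁, min δ' (δ / c), lt_min hδ' (by positivity), fun y n hn hy b hb => ?_⟩
    rcases hb with rfl | hb
    · have h1 : ∑ j ∈ J₁, l2Norm τ (T j y - y) ≤ J₁.card * (δ / c * n) := by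
        rw [← nsmul_eq_mul]
        refine Finset.sum_le_card_nsmul _ _ _ fun j hj => (hy j (Finset.mem_union_right _ hj)).trans ?_
        exact mul_le_mul_of_nonneg_right (min_le_right _ _) hn
      have h2 : 0 ≤ ∑ j ∈ J₁, l2Norm τ (T j y - y) := Finset.sum_nonneg fun j _ => l2Norm_nonneg _
      calc _ ≤ C * ∑ j ∈ J₁, l2Norm τ (T j y - y) := hC y
        _ ≤ |C| * ∑ j ∈ J₁, l2Norm τ (T j y - y) :=
          mul_le_mul_of_nonneg_right (le_abs_self C) h2
        _ ≤ |C| * (J₁.card * (δ / c * n)) := mul_le_mul_of_nonneg_left h1 (abs_nonneg C)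
        _ = (|C| * J₁.card) * (δ / c * n) := by ring
        _ ≤ c * (δ / c * n) := mul_le_mul_of_nonneg_right (by rw [hc]; linarith) (by positivity)
        _ = δ * n := by field_simp
    · exact hJ y n hn (fun j hj => (hy j (Finset.mem_union_left _ hj)).trans
        (mul_le_mul_of_nonneg_right (min_le_left _ _) hn)) b hb

end IsFaithfulTracialState

open IsFaithfulTracialState in
/-- If bounded almost fixed elements are almost scalar then the automorphisms have a spectral
gap on the orthogonal complement of the scalars. -/
theorem IsFactorTrace.exists_spectral_gap {A : Type*} [CStarAlgebra A] [PartialOrder A]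
    [StarOrderedRing A] {τ : A →ₗ[ℂ] ℂ} {Λ : Type*} [DecidableEq Λ] {T : Λ → A ≃⋆ₐ[ℂ] A}
    (h : IsFactorTrace τ) (hT : AlmostFixedAreScalar T τ) (hcomm : ControlsCommutators T τ) :
    ∃ (J : Finset Λ) (κ : ℝ), 0 < κ ∧
      ∀ x : A, l2Norm τ (x - τ x • 1) ≤ κ * ∑ j ∈ J, l2Norm τ (T j x - x) := by
  by_contra hcon
  push Not at hcon
  obtain ⟨J, δ, hδ, hJ⟩ := hT (1 / 8) (by norm_num) 1
  set ε : ℝ := min (δ ^ 2) (1 / 4) with hε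
  have hε0 : 0 < ε := lt_min (by positivity) (by norm_num)
  have hεδ : ε ≤ δ ^ 2 := min_le_left _ _
  have hε4 : ε ≤ 1 / 4 := min_le_right _ _
  obtain ⟨q, ⟨hq0, hq1, hq4, hqp, hqT⟩, hq8⟩ := h.exists_almostInvariant
    (fun j : J => T j) hε0 fun F hF δ₁ hδ₁ => by
      obtain ⟨J₁, δ₂, hδ₂, hF'⟩ := hcomm.finite hF hδ₁
      obtain ⟨y, hy0, hy1, hyn, hyT, hyd, hys⟩ := h.exists_small_almostInvariant hT hcon (J ∪ J₁)
        (lt_min hδ₁ hδ₂)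
      have hm := min_le_left δ₁ δ₂
      refine ⟨y, hy0, hy1, hyn, hF' y _ hyn.le fun j hj => ?_, fun j => ?_, ?_, hys.trans hm⟩
      · exact (hyT j (Finset.mem_union_right _ hj)).trans
          (mul_le_mul_of_nonneg_right (min_le_right _ _) hyn.le)
      · exact (hyT j (Finset.mem_union_left _ j.2)).trans (mul_le_mul_of_nonneg_right hm hyn.le)
      · exact hyd.trans (mul_le_mul_of_nonneg_right hm (sq_nonneg _))
  set t := (τ q).re with ht
  have hqs : IsSelfAdjoint q := IsSelfAdjoint.of_nonneg hq0
  have hscal := hJ q (norm_le_one_of_nonneg hq0 hq1) fun j hj => by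
    refine (pow_le_pow_iff_left₀ (l2Norm_nonneg _) hδ.le two_ne_zero).mp ((hqT ⟨j, hj⟩).trans ?_)
    nlinarith
  have hsq : l2Norm τ (q - τ q • 1) ^ 2 = l2Norm τ q ^ 2 - t ^ 2 := by
    rw [h.map_of_isSelfAdjoint hqs, ← ht, sub_eq_add_neg, ← neg_smul, ← Complex.ofReal_neg,
      Complex.coe_smul, h.l2Norm_add_sq hqs (IsSelfAdjoint.smul (IsSelfAdjoint.all _)
      (IsSelfAdjoint.one A)), mul_smul_comm, mul_one, re_smul_real, ← Complex.coe_smul,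
      h.l2Norm_algebraMap, Complex.norm_real, Real.norm_eq_abs, sq_abs]
    ring
  -- Now ‖q‖₂² - t² ≥ t(1 - ε - t) ≥ t/2 ≥ 1/16, against the upper bound 1/64.
  have h2 := pow_le_pow_left₀ (l2Norm_nonneg _) hscal 2
  rw [hsq] at h2
  nlinarith

/-! ### Weak operator limits, suprema and primeness in von Neumann algebras -/

section WeakLimit

variable {H : Type*} [NormedAddCommGroup H] [InnerProductSpace ℂ H] [CompleteSpace H]
  {ι : Type*}

/-- A bounded family of operators converges weakly along every ultrafilter. -/
lemma Ultrafilter.exists_weakOperator_limit (𝒰 : Ultrafilter ι) (x : ι → H →L[ℂ] H) {C : ℝ}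
    (hx : ∀ᶠ i in (𝒰 : Filter ι), ‖x i‖ ≤ C) :
    ∃ X : H →L[ℂ] H, ‖X‖ ≤ C ∧
      ∀ v w, Tendsto (fun i => inner ℂ (x i v) w) 𝒰 (𝓝 (inner ℂ (X v) w)) := by
  have hC : 0 ≤ C := by
    obtain ⟨i, hi⟩ := hx.exists
    exact (norm_nonneg _).trans hi
  have hb : ∀ v w, ∀ᶠ i in (𝒰 : Filter ι), ‖inner ℂ (x i v) w‖ ≤ C * ‖v‖ * ‖w‖ := by
    intro v w
    filter_upwards [hx] with i hi
    refine (norm_inner_le_norm _ _).trans ?_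
    gcongr
    exact (x i).le_of_opNorm_le hi v
  have hlim : ∀ v w, ∃ z : ℂ, ‖z‖ ≤ C * ‖v‖ * ‖w‖ ∧
      Tendsto (fun i => inner ℂ (x i v) w) 𝒰 (𝓝 z) := by
    intro v w
    have hk : IsCompact (Metric.closedBall (0 : ℂ) (C * ‖v‖ * ‖w‖)) := isCompact_closedBall _ _
    obtain ⟨z, hz, hzz⟩ := hk.ultrafilter_le_nhds (𝒰.map fun i => inner ℂ (x i v) w) (by
      rw [le_principal_iff, Ultrafilter.coe_map, Filter.mem_map]
      filter_upwards [hb v w] with i hi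
      simpa using hi)
    exact ⟨z, by simpa using hz, hzz⟩
  choose b hbn hbt using hlim
  -- Uniqueness of limits makes the limit form sesquilinear. It is bounded by C, so Riesz
  -- representation yields the operator.
  let B₀ : H →ₗ⋆[ℂ] H →ₗ[ℂ] ℂ := LinearMap.mk₂'ₛₗ _ _ b
    (fun v v' w => tendsto_nhds_unique (hbt _ _)
      (by simpa [inner_add_left] using (hbt v w).add (hbt v' w)))
    (fun c v w => tendsto_nhds_unique (hbt _ _)
      (by simpa [inner_smul_left, mul_comm] using (hbt v w).const_mul (star c)))
    (fun v w w' => tendsto_nhds_unique (hbt _ _)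
      (by simpa [inner_add_right] using (hbt v w).add (hbt v w')))
    (fun c v w => tendsto_nhds_unique (hbt _ _)
      (by simpa [inner_smul_right] using (hbt v w).const_mul c))
  let B : H →L⋆[ℂ] H →L[ℂ] ℂ := B₀.mkContinuous₂ C hbn
  have hB : ∀ v w, inner ℂ (InnerProductSpace.continuousLinearMapOfBilin B v) w = b v w :=
    fun v w => InnerProductSpace.continuousLinearMapOfBilin_apply B v w
  refine ⟨InnerProductSpace.continuousLinearMapOfBilin B,
    ContinuousLinearMap.opNorm_le_bound _ hC fun v => ?_, fun v w => by rw [hB]; exact hbt v w⟩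
  set X := InnerProductSpace.continuousLinearMapOfBilin B
  have h1 : ‖X v‖ * ‖X v‖ ≤ C * ‖v‖ * ‖X v‖ := by
    have := hbn v (X v)
    rw [← hB, inner_self_eq_norm_sq_to_K] at this
    simpa [sq] using this
  rcases (norm_nonneg (X v)).eq_or_lt with h0 | h0
  · rw [← h0]; positivity
  · exact le_of_mul_le_mul_right h1 h0

variable {𝒰 : Filter ι} [𝒰.NeBot] {x : ι → H →L[ℂ] H} {X : H →L[ℂ] H}

/-- Multiplication by a fixed operator is weakly continuous: a left factor moves to the other side
of the inner product as its adjoint. -/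
lemma mul_mul_eq_of_weakOperator_tendsto
    (hX : ∀ v w, Tendsto (fun i => inner ℂ (x i v) w) 𝒰 (𝓝 (inner ℂ (X v) w)))
    {a b c d : H →L[ℂ] H} (h : ∀ᶠ i in 𝒰, a * x i * b = c * x i * d) :
    a * X * b = c * X * d := by
  ext v
  refine ext_inner_right ℂ fun w => ?_
  have h1 := hX (b v) (a.adjoint w)
  have h2 := hX (d v) (c.adjoint w)
  simp only [ContinuousLinearMap.adjoint_inner_right] at h1 h2
  refine tendsto_nhds_unique h1 (h2.congr' ?_)
  filter_upwards [h] with i hi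
  exact congrArg (fun y : H →L[ℂ] H => inner ℂ (y v) w) hi.symm

lemma nonneg_of_weakOperator_tendsto
    (hX : ∀ v w, Tendsto (fun i => inner ℂ (x i v) w) 𝒰 (𝓝 (inner ℂ (X v) w)))
    (h : ∀ᶠ i in 𝒰, 0 ≤ x i) : 0 ≤ X := by
  rw [ContinuousLinearMap.nonneg_iff_isPositive, ContinuousLinearMap.isPositive_iff_complex]
  intro v
  have h0 : (0 : ℂ) ≤ inner ℂ (X v) v := by
    refine ge_of_tendsto (hX v v) ?_
    filter_upwards [h] with i hi
    rw [ContinuousLinearMap.nonneg_iff_isPositive] at hi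
    exact hi.inner_nonneg_left v
  rw [Complex.nonneg_iff] at h0
  exact ⟨Complex.ext (by simp) (by simpa using h0.2), h0.1⟩

end WeakLimit

namespace VonNeumannAlgebra

variable {H : Type*} [NormedAddCommGroup H] [InnerProductSpace ℂ H] [CompleteSpace H]
  (N : VonNeumannAlgebra H)

lemma isClosed : IsClosed (N.toStarSubalgebra : Set (H →L[ℂ] H)) := by
  rw [VonNeumannAlgebra.coe_toStarSubalgebra, ← N.centralizer_centralizer]
  exact Set.isClosed_centralizer _

attribute [local instance] VonNeumannAlgebra.isClosed

variable {N}

lemma mem_of_commute {x : H →L[ℂ] H} (h : ∀ y ∈ N.commutant, y * x = x * y) : x ∈ N := by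
  rw [← N.commutant_commutant, mem_commutant_iff]
  exact h

lemma mul_comm_of_mem_commutant {x y : H →L[ℂ] H} (hx : x ∈ N) (hy : y ∈ N.commutant) :
    y * x = x * y := (mem_commutant_iff.1 hy x hx).symm

/-- Whatever commutes with x commutes with its functional calculus; the bicommutant property does
the rest. -/
lemma sqrt_mem {x : H →L[ℂ] H} (hx : x ∈ N) : CFC.sqrt x ∈ N := by
  refine mem_of_commute fun y hy => ?_
  have : Commute x y := (mul_comm_of_mem_commutant hx hy).symm
  exact (this.cfcₙ_nnreal _).symm

/-- Square roots stay in N, so the order inherited from the operators on H is the intrinsic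
C⋆-order. -/
lemma starOrderedRing : StarOrderedRing N.toStarSubalgebra := by
  refine StarOrderedRing.of_nonneg_iff' (fun {x y} h z => ?_) fun x => ⟨fun h => ?_, ?_⟩
  · exact add_le_add_right (show (x : H →L[ℂ] H) ≤ y from h) (z : H →L[ℂ] H)
  · have h' : 0 ≤ (x : H →L[ℂ] H) := h
    refine ⟨⟨CFC.sqrt (x : H →L[ℂ] H), sqrt_mem x.2⟩, Subtype.ext ?_⟩
    change (x : H →L[ℂ] H) = star (CFC.sqrt (x : H →L[ℂ] H)) * CFC.sqrt (x : H →L[ℂ] H)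
    rw [(CFC.sqrt_nonneg (x : H →L[ℂ] H)).isSelfAdjoint.star_eq,
      CFC.sqrt_mul_sqrt_self _ h']
  · rintro ⟨s, rfl⟩
    exact star_mul_self_nonneg (s : H →L[ℂ] H)

attribute [local instance] VonNeumannAlgebra.starOrderedRing

lemma mem_of_weakOperator_tendsto {ι : Type*} {𝒰 : Filter ι} [𝒰.NeBot] {x : ι → H →L[ℂ] H}
    {X : H →L[ℂ] H}
    (hX : ∀ v w, Tendsto (fun i => inner ℂ (x i v) w) 𝒰 (𝓝 (inner ℂ (X v) w)))
    (h : ∀ᶠ i in 𝒰, x i ∈ N) : X ∈ N := by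
  refine mem_of_commute fun y hy => ?_
  have := mul_mul_eq_of_weakOperator_tendsto hX (a := y) (b := 1) (c := 1) (d := y) (by
    filter_upwards [h] with i hi
    simpa using mul_comm_of_mem_commutant hi hy)
  simpa using this

/-- The supremum is the weak limit of D along an ultrafilter finer than its tails; inequalities pass
to weak limits. -/
theorem exists_isLUB_of_directedOn (D : Set N.toStarSubalgebra) (hne : D.Nonempty)
    (hD : DirectedOn (· ≤ ·) D) (hD1 : ∀ d ∈ D, 0 ≤ d ∧ d ≤ 1) : ∃ a, IsLUB D a := by
  have : Nonempty D := hne.to_subtype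
  have : IsDirectedOrder D := directedOn_iff_isDirectedOrder.1 hD
  let 𝒰 : Ultrafilter D := Ultrafilter.of atTop
  have h𝒰 : (𝒰 : Filter D) ≤ atTop := Ultrafilter.of_le _
  obtain ⟨X, -, hX⟩ := 𝒰.exists_weakOperator_limit (fun d : D => (d : H →L[ℂ] H)) (C := 1)
    (Eventually.of_forall fun d =>
      IsFaithfulTracialState.norm_le_one_of_nonneg (A := N.toStarSubalgebra) (hD1 d d.2).1 (hD1 d d.2).2)
  have hXN : X ∈ N := mem_of_weakOperator_tendsto hX (Eventually.of_forall fun d => d.1.2)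
  refine ⟨⟨X, hXN⟩, fun d hd => ?_, fun b hb => ?_⟩
  · change (d : H →L[ℂ] H) ≤ X
    rw [← sub_nonneg]
    refine nonneg_of_weakOperator_tendsto (𝒰 := (𝒰 : Filter D))
      (x := fun i : D => (i : H →L[ℂ] H) - (d : H →L[ℂ] H)) (fun v w => ?_) ?_
    · simpa [inner_sub_left] using (hX v w).sub_const (inner ℂ ((d : H →L[ℂ] H) v) w)
    · filter_upwards [h𝒰 (eventually_ge_atTop (⟨d, hd⟩ : D))] with i hi
      rw [sub_nonneg]
      exact hi
  · change X ≤ (b : H →L[ℂ] H)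
    rw [← sub_nonneg]
    refine nonneg_of_weakOperator_tendsto (𝒰 := (𝒰 : Filter D))
      (x := fun i : D => (b : H →L[ℂ] H) - (i : H →L[ℂ] H)) (fun v w => ?_) ?_
    · simpa [inner_sub_left] using (hX v w).const_sub (inner ℂ ((b : H →L[ℂ] H) v) w)
    · refine Eventually.of_forall fun i => ?_
      rw [sub_nonneg]
      exact hb i.2

/-- Factors are prime. -/
theorem IsFactor.eq_zero_or_eq_zero (hN : N.IsFactor) {a b : N.toStarSubalgebra}
    (h : ∀ y, a * y * b = 0) : a = 0 ∨ b = 0 := by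
  -- The closure K of NbH is invariant under N and its commutant, so its projection is central,
  -- hence a scalar c. If c = 0 then b = 0; otherwise K is all of H, and a vanishes on K.
  let V : Submodule ℂ H :=
    Submodule.span ℂ {w | ∃ (y : N.toStarSubalgebra) (v : H), w = (y : H →L[ℂ] H) ((b : H →L[ℂ] H) v)}
  let K : Submodule ℂ H := V.topologicalClosure
  have : CompleteSpace K := V.isClosed_topologicalClosure.completeSpace_coe
  have hinv : ∀ y : H →L[ℂ] H, (y ∈ N ∨ y ∈ N.commutant) → ∀ w ∈ K, y w ∈ K := by
    intro y hy
    have hV : ∀ w ∈ V, y w ∈ V := by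
      intro w hw
      induction hw using Submodule.span_induction with
      | mem w hw =>
        obtain ⟨z, v, rfl⟩ := hw
        rcases hy with hy | hy
        · exact Submodule.subset_span ⟨⟨y, hy⟩ * z, v, rfl⟩
        · refine Submodule.subset_span ⟨z, y v, ?_⟩
          have := congrArg (fun t : H →L[ℂ] H => t v)
            (mul_comm_of_mem_commutant (z * b).2 hy)
          exact this
      | zero => simp
      | add w w' _ _ h1 h2 => rw [map_add]; exact V.add_mem h1 h2
      | smul c w _ h1 => rw [map_smul]; exact V.smul_mem c h1
    intro w hw
    exact map_mem_closure (s := (V : Set H)) (t := (V : Set H)) y.continuous hw hV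
  let z : H →L[ℂ] H := K.starProjection
  have hz : IsStarProjection z := isStarProjection_starProjection
  have hr : z.range = K := Submodule.range_starProjection K
  have hzN : z ∈ N := by
    rw [IsStarProjection.mem_iff hz, hr]
    exact fun y hy w hw => hinv y (Or.inr hy) w hw
  have hzN' : z ∈ N.commutant := by
    rw [IsStarProjection.mem_iff hz, hr, N.commutant_commutant]
    exact fun y hy w hw => hinv y (Or.inl hy) w hw
  obtain ⟨c, hc⟩ := hN ⟨z, hzN⟩ fun y => Subtype.ext (mem_commutant_iff.1 hzN' y y.2)
  have hzc : z = c • 1 := congrArg Subtype.val hc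
  have hzb : ∀ v, z ((b : H →L[ℂ] H) v) = (b : H →L[ℂ] H) v := fun v =>
    Submodule.starProjection_eq_self_iff.2
      (V.le_topologicalClosure (Submodule.subset_span ⟨1, v, rfl⟩))
  have haK : ∀ w ∈ K, (a : H →L[ℂ] H) w = 0 := by
    have hV : V ≤ (a : H →L[ℂ] H).ker := by
      refine Submodule.span_le.2 ?_
      rintro _ ⟨y, v, rfl⟩
      exact congrArg (fun t : N.toStarSubalgebra => (t : H →L[ℂ] H) v) (h y)
    exact V.topologicalClosure_minimal hV (a : H →L[ℂ] H).isClosed_ker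
  by_cases hc0 : c = 0
  · right
    ext v
    have := hzb v
    rw [hzc, hc0] at this
    simpa using this.symm
  · left
    ext v
    have h1 := haK (z v) (K.starProjection_apply_mem v)
    rw [hzc] at h1
    simpa [hc0] using h1

end VonNeumannAlgebra

/-! ### Extreme points of corners and partial isometries -/

section Comparison

variable {A : Type*} [CStarAlgebra A] [PartialOrder A] [StarOrderedRing A]

lemma norm_le_one_iff_star_mul_self_le_one {x : A} : ‖x‖ ≤ 1 ↔ star x * x ≤ 1 := by
  rw [← CStarAlgebra.norm_le_one_iff_of_nonneg (star x * x) (star_mul_self_nonneg x),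
    CStarRing.norm_star_mul_self]
  constructor
  · intro h; nlinarith [norm_nonneg x]
  · intro h; nlinarith [norm_nonneg x]

/-- With d = 1 - x*x the perturbed element is x(1 + td), whose square is (1 + td)(1 - d)(1 + td), a
polynomial in 0 ≤ d ≤ 1 that stays below 1 for t = ±1/4. At an extreme point the perturbation must
therefore vanish. -/
lemma norm_add_smul_defect_le_one {x : A} (hx : ‖x‖ ≤ 1) :
    ‖x + (1 / 4 : ℝ) • (x - x * star x * x)‖ ≤ 1 ∧
      ‖x - (1 / 4 : ℝ) • (x - x * star x * x)‖ ≤ 1 := by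
  obtain ⟨d, hd⟩ : ∃ d, d = 1 - star x * x := ⟨_, rfl⟩
  have hp : star x * x = 1 - d := by rw [hd]; abel
  have h0 : 0 ≤ d := by rw [hd, sub_nonneg]; exact norm_le_one_iff_star_mul_self_le_one.1 hx
  have h1 : d ≤ 1 := by rw [hd]; exact sub_le_self _ (star_mul_self_nonneg x)
  have hs : star d = d := h0.isSelfAdjoint.star_eq
  have h2 : d * d ≤ d := IsFaithfulTracialState.mul_self_le_self h0 h1
  have h20 : 0 ≤ d * d := by simpa [hs] using star_mul_self_nonneg d
  have h3 : 0 ≤ d * d * d := by simpa [hs] using star_left_conjugate_nonneg h0 d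
  have key : ∀ t : ℝ, star (x + t • (x - x * star x * x)) * (x + t • (x - x * star x * x))
      = 1 + (2 * t - 1) • d + (t ^ 2 - 2 * t) • (d * d) - t ^ 2 • (d * d * d) := by
    intro t
    have hw : x + t • (x - x * star x * x) = x * (1 + t • d) := by
      rw [hd]
      simp only [mul_add, mul_sub, mul_one, mul_smul_comm, smul_sub, mul_assoc]
    rw [hw]
    have : star (x * (1 + t • d)) * (x * (1 + t • d))
        = (1 + t • d) * (star x * x) * (1 + t • d) := by
      simp [star_mul, hs, mul_assoc]
    rw [this, hp]
    simp only [mul_add, add_mul, mul_sub, sub_mul, one_mul, mul_one, smul_mul_assoc,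
      mul_smul_comm, smul_sub, smul_add, smul_smul, mul_assoc]
    module
  constructor
  · rw [norm_le_one_iff_star_mul_self_le_one, key, ← sub_nonneg]
    have : (0 : A) ≤ (1 / 2 : ℝ) • d + (7 / 16 : ℝ) • (d * d) + (1 / 16 : ℝ) • (d * d * d) := by
      have := smul_nonneg (show (0 : ℝ) ≤ 1 / 2 by norm_num) h0
      have := smul_nonneg (show (0 : ℝ) ≤ 7 / 16 by norm_num) h20
      have := smul_nonneg (show (0 : ℝ) ≤ 1 / 16 by norm_num) h3
      positivity
    convert this using 1
    module
  · have hk := key (-(1 / 4))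
    rw [neg_smul, ← sub_eq_add_neg] at hk
    rw [norm_le_one_iff_star_mul_self_le_one, hk, ← sub_nonneg]
    have : (0 : A) ≤ (15 / 16 : ℝ) • d + (9 / 16 : ℝ) • (d - d * d) + (1 / 16 : ℝ) • (d * d * d) :=
      add_nonneg (add_nonneg (smul_nonneg (by norm_num) h0)
        (smul_nonneg (by norm_num) (sub_nonneg.2 h2))) (smul_nonneg (by norm_num) h3)
    convert this using 1
    module

/-- An extreme point of the unit ball of `e A (1 - e)` is a partial isometry `x` with
`(e - x x*) A (1 - e - x* x) = 0`. -/
lemma partialIsometry_of_extreme {e x : A} (he : IsStarProjection e) (hx : ‖x‖ ≤ 1)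
    (hex : e * x * (1 - e) = x)
    (hext : ∀ z, e * z * (1 - e) = z → ‖x + z‖ ≤ 1 → ‖x - z‖ ≤ 1 → z = 0) :
    x * star x * x = x ∧ ∀ y, (e - x * star x) * y * (1 - e - star x * x) = 0 := by
  have hee : e * e = e := he.isIdempotentElem
  have hse : star e = e := he.isSelfAdjoint.star_eq
  have hff : (1 - e) * (1 - e) = 1 - e := he.isIdempotentElem.one_sub
  have hex1 : e * x = x := by
    rw [← hex, ← mul_assoc, ← mul_assoc, hee]
  have hxf : x * (1 - e) = x := by
    conv_lhs => rw [← hex]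
    rw [mul_assoc, hff, hex]
  have hsx : star x * e = star x := by simpa [hse] using congrArg star hex1
  have hfx : (1 - e) * star x = star x := by simpa [hse] using congrArg star hxf
  have hpi : x * star x * x = x := by
    obtain ⟨h1, h2⟩ := norm_add_smul_defect_le_one hx
    have := hext ((1 / 4 : ℝ) • (x - x * star x * x)) (by
      rw [mul_smul_comm, smul_mul_assoc, mul_sub e, sub_mul _ _ (1 - e), hex]
      congr 2
      rw [← mul_assoc, ← mul_assoc, hex1, mul_assoc, hxf]) h1 h2
    rw [smul_eq_zero, or_iff_right (by norm_num), sub_eq_zero] at this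
    exact this.symm
  refine ⟨hpi, fun y => ?_⟩
  have hpi' : star x * (x * star x) = star x := by simpa [mul_assoc] using congrArg star hpi
  obtain ⟨q, hq⟩ : ∃ q, q = 1 - e - star x * x := ⟨_, rfl⟩
  have hqs : star q = q := by rw [hq]; simp [hse]
  have hqf : q * (1 - e) = q := by
    rw [hq, sub_mul, hff, mul_assoc, hxf]
  have hqq : q * q = q := by
    have h1 : (1 - e) * q = q := by
      rw [hq, mul_sub, hff, ← mul_assoc, hfx]
    have h2 : star x * x * q = 0 := by
      rw [hq, mul_sub, mul_assoc, hxf, mul_assoc, ← mul_assoc x, hpi, sub_self]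
    calc q * q = (1 - e) * q - star x * x * q := by rw [← sub_mul, ← hq]
      _ = q := by rw [h1, h2, sub_zero]
  have hxr : star x * (e - x * star x) = 0 := by rw [mul_sub, hsx, hpi', sub_self]
  have her : e * (e - x * star x) = e - x * star x := by
    rw [mul_sub, hee, ← mul_assoc, hex1]
  rw [← hq]
  obtain ⟨z, hz⟩ : ∃ z, z = (e - x * star x) * y * q := ⟨_, rfl⟩
  rw [← hz]
  have hzq : z * q = z := by rw [hz, mul_assoc, hqq]
  have hxz : star x * z = 0 := by rw [hz, ← mul_assoc, ← mul_assoc, hxr, zero_mul, zero_mul]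
  have hzx : star z * x = 0 := by simpa using congrArg star hxz
  have hez : e * z * (1 - e) = z := by
    rw [hz, ← mul_assoc, ← mul_assoc, her, mul_assoc, hqf]
  have hq1 : star x * x + q ≤ 1 := by
    rw [hq, add_sub_cancel]
    exact sub_le_self _ (by simpa [hse, hee] using star_mul_self_nonneg e)
  -- Since x*z = 0 there are no cross terms, and z = zq puts the square of c • z under q, which fits
  -- beside x*x below 1. So small multiples of z perturb x within the ball in both directions.
  have hsmall : ∀ c : ℝ, ‖c • z‖ ≤ 1 → ‖x + c • z‖ ≤ 1 := by
    intro c hc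
    rw [norm_le_one_iff_star_mul_self_le_one] at hc ⊢
    have h1 : star (c • z) * (c • z) ≤ q := by
      have := star_left_conjugate_le_conjugate hc q
      have h2 : star q * (star (c • z) * (c • z)) * q = star (c • z) * (c • z) := by
        have : (c • z) * q = c • z := by rw [smul_mul_assoc, hzq]
        calc _ = star ((c • z) * q) * ((c • z) * q) := by simp only [star_mul, mul_assoc]
          _ = _ := by rw [this]
      rwa [h2, mul_one, hqs, hqq] at this
    refine le_trans ?_ hq1
    have h3 : star (x + c • z) * (x + c • z) = star x * x + star (c • z) * (c • z) := by
      simp [mul_add, add_mul, hxz, hzx]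
    rw [h3]
    gcongr
  have hn : ‖(‖z‖ + 1)⁻¹ • z‖ ≤ 1 := by
    rw [norm_smul, norm_inv, Real.norm_of_nonneg (by positivity), inv_mul_le_one₀ (by positivity)]
    linarith
  have := hext ((‖z‖ + 1)⁻¹ • z) (by rw [mul_smul_comm, smul_mul_assoc, hez]) (hsmall _ hn) (by
    rw [sub_eq_add_neg, ← neg_smul]
    exact hsmall _ (by rwa [neg_smul, norm_neg]))
  rwa [smul_eq_zero, or_iff_right (by positivity)] at this

end Comparison

/-! ### Comparison in a II₁ factor -/

namespace VonNeumannAlgebra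

variable {H : Type*} [NormedAddCommGroup H] [InnerProductSpace ℂ H] [CompleteSpace H]
  {N : VonNeumannAlgebra H} {τ : N.toStarSubalgebra →ₗ[ℂ] ℂ}

attribute [local instance] VonNeumannAlgebra.isClosed VonNeumannAlgebra.starOrderedRing

-- Krein–Milman: the unit ball of the corner is compact in the weak operator topology, so it has an
-- extreme point x, and x is the midpoint of x + z and x - z.
open ContinuousLinearMapWOT in
lemma exists_extreme (e f : N.toStarSubalgebra) : ∃ x : N.toStarSubalgebra, ‖x‖ ≤ 1 ∧
    e * x * f = x ∧ ∀ z, e * z * f = z → ‖x + z‖ ≤ 1 → ‖x - z‖ ≤ 1 → z = 0 := by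
  let C : Set (H →WOT[ℂ] H) := {x | toCLM x ∈ N ∧ ‖toCLM x‖ ≤ 1 ∧
    (e : H →L[ℂ] H) * toCLM x * (f : H →L[ℂ] H) = toCLM x}
  have hC : IsCompact C := by
    rw [isCompact_iff_ultrafilter_le_nhds]
    intro 𝒰 h𝒰
    rw [le_principal_iff] at h𝒰
    obtain ⟨X, hX1, hX⟩ := 𝒰.exists_weakOperator_limit (fun x : H →WOT[ℂ] H => toCLM x) (C := 1)
      (by filter_upwards [h𝒰] with x hx using hx.2.1)
    refine ⟨ofCLM X, ⟨mem_of_weakOperator_tendsto hX ?_, hX1, ?_⟩, ?_⟩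
    · filter_upwards [h𝒰] with x hx using hx.1
    · have := mul_mul_eq_of_weakOperator_tendsto hX (a := e) (b := f) (c := 1) (d := 1) (by
        filter_upwards [h𝒰] with x hx
        simpa using hx.2.2)
      simpa using this
    · rw [le_nhds_iff_forall_inner_apply_le_nhds]
      intro v w
      have h1 := (Complex.continuous_conj.tendsto _).comp (hX v w)
      simp only [inner_conj_symm, Function.comp_def] at h1
      exact h1
  have hne : C.Nonempty := ⟨0, N.toStarSubalgebra.zero_mem, by simp, by simp⟩
  obtain ⟨x, hxC, hx⟩ := hC.extremePoints_nonempty hne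
  refine ⟨⟨toCLM x, hxC.1⟩, hxC.2.1, Subtype.ext hxC.2.2, fun z hz h1 h2 => ?_⟩
  have hz' : (e : H →L[ℂ] H) * z * (f : H →L[ℂ] H) = z := congrArg Subtype.val hz
  have hplus : x + ofCLM (z : H →L[ℂ] H) ∈ C := by
    refine ⟨N.toStarSubalgebra.add_mem hxC.1 z.2, h1, ?_⟩
    simp only [toCLM_add, mul_add, add_mul, hxC.2.2, hz']
  have hminus : x - ofCLM (z : H →L[ℂ] H) ∈ C := by
    refine ⟨N.toStarSubalgebra.sub_mem hxC.1 z.2, h2, ?_⟩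
    simp only [toCLM_sub, mul_sub, sub_mul, hxC.2.2, hz']
  have := hx hplus hminus ⟨1 / 2, 1 / 2, by norm_num, by norm_num, by norm_num, by module⟩
  have h0 : ofCLM (z : H →L[ℂ] H) = 0 := by simpa using this
  exact Subtype.ext (ofCLM_injective h0)

/-- The trace of a II₁ factor has the order-theoretic and comparison properties collected in
`IsFactorTrace`. -/
theorem _root_.IsIIOneFactor.isFactorTrace (hN : IsIIOneFactor N τ) : IsFactorTrace τ := by
  have hτ : IsFaithfulTracialState τ :=
    ⟨hN.trace.map_one, hN.trace.nonneg, hN.trace.tracial, hN.trace.faithful⟩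
  refine ⟨hτ, exists_isLUB_of_directedOn, hN.trace.normal, fun e he h2 => ?_⟩
  have hee : e * e = e := he.isIdempotentElem
  have hse : star e = e := he.isSelfAdjoint.star_eq
  obtain ⟨x, hx1, hex, hext⟩ := exists_extreme e (1 - e)
  obtain ⟨hpi, hy⟩ := partialIsometry_of_extreme he hx1 hex hext
  have hex1 : e * x = x := by
    rw [← hex, ← mul_assoc, ← mul_assoc, hee]
  refine ⟨x, hx1, ?_⟩
  rw [mul_assoc, hex1]
  -- Primeness gives xx* = e or x*x = 1 - e. In the first case x*x ≤ 1 - e while τ(x*x) = τ(e) ≥ 1/2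
  -- ≥ τ(1 - e), so faithfulness forces equality.
  rcases hN.factor.eq_zero_or_eq_zero hy with h | h
  · rw [sub_eq_zero] at h
    have hle : star x * x ≤ 1 - e := by
      have := star_left_conjugate_le_conjugate (norm_le_one_iff_star_mul_self_le_one.1 hx1) (1 - e)
      have hxf : x * (1 - e) = x := by
        conv_lhs => rw [← hex]
        rw [mul_assoc, he.isIdempotentElem.one_sub, hex]
      have h3 : star (1 - e) * (star x * x) * (1 - e) = star x * x := by
        calc _ = star (x * (1 - e)) * (x * (1 - e)) := by simp only [star_mul, mul_assoc]
          _ = _ := by rw [hxf]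
      rw [h3, mul_one] at this
      simpa [hse, he.isIdempotentElem.one_sub.eq] using this
    have h0 := hτ.eq_zero_of_re (sub_nonneg.2 hle) (by
      rw [map_sub, map_sub, hτ.tracial (star x) x, ← h, hτ.map_one]
      simp only [Complex.sub_re, Complex.one_re]
      linarith)
    exact (sub_eq_zero.1 h0).symm
  · exact (sub_eq_zero.1 h).symm

end VonNeumannAlgebra

/-! ### Inner automorphisms and the passage from nets to uniform statements -/

namespace IsFaithfulTracialState

variable {A : Type*} [CStarAlgebra A] [PartialOrder A] [StarOrderedRing A] {τ : A →ₗ[ℂ] ℂ}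
  {Γ : Type*}

/-- The family of automorphisms made of all inner automorphisms and a given family `σ`. -/
noncomputable def withInner (σ : Γ → A ≃⋆ₐ[ℂ] A) : unitary A ⊕ Γ → A ≃⋆ₐ[ℂ] A :=
  Sum.elim (fun u => Unitary.conjStarAlgAut ℂ A u) σ

lemma l2Norm_withInner_inl (h : IsFaithfulTracialState τ) (σ : Γ → A ≃⋆ₐ[ℂ] A) (u : unitary A)
    (x : A) : l2Norm τ (withInner σ (Sum.inl u) x - x) = l2Norm τ (u * x - x * u) := by
  rw [← h.l2Norm_unitary_conj_sub]
  simp [withInner, Unitary.conjStarAlgAut_apply]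

/-- Every element is a linear combination of unitaries, and commutators with unitaries are
displacements under inner automorphisms. -/
lemma controlsCommutators_withInner (h : IsFaithfulTracialState τ) (σ : Γ → A ≃⋆ₐ[ℂ] A) :
    ControlsCommutators (withInner σ) τ := by
  classical
  intro a
  have ha : a ∈ Submodule.span ℂ (unitary A : Set A) := by
    rw [CStarAlgebra.span_unitary]; trivial
  -- Nonnegativity of C is added so that the index set can be enlarged in the induction.
  suffices ∃ J : Finset (unitary A ⊕ Γ), ∃ C : ℝ, 0 ≤ C ∧ ∀ y,
      l2Norm τ (a * y - y * a) ≤ C * ∑ j ∈ J, l2Norm τ (withInner σ j y - y) by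
    obtain ⟨J, C, -, hJ⟩ := this
    exact ⟨J, C, hJ⟩
  induction ha using Submodule.span_induction with
  | mem u hu =>
    refine ⟨{Sum.inl ⟨u, hu⟩}, 1, zero_le_one, fun y => ?_⟩
    rw [Finset.sum_singleton, h.l2Norm_withInner_inl, one_mul]
  | zero => exact ⟨∅, 0, le_rfl, fun y => by simp [l2Norm_zero]⟩
  | add a b _ _ iha ihb =>
    obtain ⟨J, C, hC, hJ⟩ := iha
    obtain ⟨K, D, hD, hK⟩ := ihb
    refine ⟨J ∪ K, C + D, add_nonneg hC hD, fun y => ?_⟩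
    have h1 : (a + b) * y - y * (a + b) = (a * y - y * a) + (b * y - y * b) := by noncomm_ring
    rw [h1, add_mul]
    refine (h.l2Norm_add_le _ _).trans (add_le_add ((hJ y).trans ?_) ((hK y).trans ?_))
    · exact mul_le_mul_of_nonneg_left (Finset.sum_le_sum_of_subset_of_nonneg
        Finset.subset_union_left fun j _ _ => l2Norm_nonneg _) hC
    · exact mul_le_mul_of_nonneg_left (Finset.sum_le_sum_of_subset_of_nonneg
        Finset.subset_union_right fun j _ _ => l2Norm_nonneg _) hD
  | smul c a _ iha =>
    obtain ⟨J, C, hC, hJ⟩ := iha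
    refine ⟨J, ‖c‖ * C, by positivity, fun y => ?_⟩
    rw [smul_mul_assoc, mul_smul_comm, ← smul_sub, h.l2Norm_smul, mul_assoc]
    gcongr
    exact hJ y

/-- If bounded nets that are asymptotically central and asymptotically fixed by `σ` are
asymptotically scalar, then so are, uniformly, the almost fixed elements of bounded sets. -/
lemma almostFixedAreScalar_withInner {A : Type u} [CStarAlgebra A] [PartialOrder A]
    [StarOrderedRing A] {τ : A →ₗ[ℂ] ℂ} {Γ : Type v} (h : IsFaithfulTracialState τ)
    (σ : Γ → A ≃⋆ₐ[ℂ] A)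
    (hσ : ∀ (I : Type (max u v)) [Preorder I] [IsDirectedOrder I] [Nonempty I] (x : I → A),
      (∃ C : ℝ, ∀ i, ‖x i‖ ≤ C) →
      (∀ a : A, Tendsto (fun i => l2Norm τ (x i * a - a * x i)) atTop (𝓝 0)) →
      (∀ g : Γ, Tendsto (fun i => l2Norm τ (σ g (x i) - x i)) atTop (𝓝 0)) →
      Tendsto (fun i => l2Norm τ (x i - τ (x i) • 1)) atTop (𝓝 0)) :
    AlmostFixedAreScalar (withInner σ) τ := by
  classical
  have hcomm := h.controlsCommutators_withInner σ
  by_contra hcon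
  simp only [AlmostFixedAreScalar, not_forall, not_exists, not_and] at hcon
  obtain ⟨ε, hε, C, hcon⟩ := hcon
  -- One counterexample for each finite set and tolerance 1/(n + 1) forms a net over the product
  -- order; its index type lies in universe `max u v`, as `hσ` requires.
  have hex : ∀ i : Finset (unitary A ⊕ Γ) × ℕ, ∃ x : A,
      ‖x‖ ≤ C ∧ (∀ j ∈ i.1, l2Norm τ (withInner σ j x - x) ≤ 1 / ((i.2 : ℝ) + 1)) ∧
        ¬ l2Norm τ (x - τ x • 1) ≤ ε := by
    intro i
    obtain ⟨x, hx⟩ := hcon i.1 (1 / ((i.2 : ℝ) + 1)) (by positivity)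
    push Not at hx
    exact ⟨x, hx.1, hx.2.1, not_le.2 hx.2.2⟩
  choose x hxC hxJ hxε using hex
  have hlim : ∀ j, Tendsto (fun i => l2Norm τ (withInner σ j (x i) - x i)) atTop (𝓝 0) := by
    intro j
    have hsnd : Tendsto (Prod.snd : Finset (unitary A ⊕ Γ) × ℕ → ℕ)
        atTop atTop := by
      rw [← prod_atTop_atTop_eq]; exact tendsto_snd
    refine squeeze_zero' (Eventually.of_forall fun i => l2Norm_nonneg _) ?_
      (tendsto_one_div_add_atTop_nhds_zero_nat.comp hsnd)
    filter_upwards [eventually_ge_atTop (({j}, 0) : Finset _ × ℕ)] with i hi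
    exact hxJ i j (hi.1 (Finset.mem_singleton_self j))
  have hmain := hσ (Finset (unitary A ⊕ Γ) × ℕ) x ⟨C, hxC⟩ (fun a => by
    obtain ⟨J, D, hJ⟩ := hcomm a
    refine squeeze_zero (g := fun i => D * ∑ j ∈ J, l2Norm τ (withInner σ j (x i) - x i))
      (fun i => l2Norm_nonneg _) (fun i => ?_) ?_
    · rw [l2Norm_sub_comm]
      exact hJ (x i)
    · simpa using (tendsto_finsetSum J fun j _ => hlim j).const_mul D)
    (fun g => hlim (Sum.inr g))
  obtain ⟨i, hi⟩ := (hmain.eventually (gt_mem_nhds hε)).exists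
  exact hxε i (le_of_lt hi)

end IsFaithfulTracialState

attribute [local instance] VonNeumannAlgebra.isClosed VonNeumannAlgebra.starOrderedRing in
/-- Spectral gap for actions on a II₁ factor without nontrivial asymptotically invariant
central nets, for the norm that the factor carries as a C⋆-algebra. -/
theorem IsIIOneFactor.exists_spectral_gap {H : Type u} [NormedAddCommGroup H]
    [InnerProductSpace ℂ H] [CompleteSpace H]
    (N : VonNeumannAlgebra H) (τ : N.toStarSubalgebra →ₗ[ℂ] ℂ) (hN : IsIIOneFactor N τ)
    {Γ : Type v} [Group Γ] (σ : Γ →* (N.toStarSubalgebra ≃⋆ₐ[ℂ] N.toStarSubalgebra))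
    (hσ : ∀ (I : Type (max u v)) [Preorder I] [IsDirectedOrder I] [Nonempty I]
      (x : I → N.toStarSubalgebra),
      (∃ C : ℝ, ∀ i, ‖x i‖ ≤ C) →
      (∀ a : N.toStarSubalgebra, Tendsto (fun i => twoNorm τ (x i * a - a * x i)) atTop (𝓝 0)) →
      (∀ g : Γ, Tendsto (fun i => twoNorm τ (σ g (x i) - x i)) atTop (𝓝 0)) →
      Tendsto (fun i => twoNorm τ (x i - τ (x i) • 1)) atTop (𝓝 0)) :
    ∃ (S : Finset (unitary N.toStarSubalgebra)) (K : Finset Γ) (κ : ℝ), 0 < κ ∧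
      ∀ x : N.toStarSubalgebra,
        twoNorm τ (x - τ x • 1) ≤
          κ * (∑ u ∈ S, twoNorm τ ((u : N.toStarSubalgebra) * x - x * u) +
            ∑ g ∈ K, twoNorm τ (σ g x - x)) := by
  classical
  have h : IsFactorTrace τ := hN.isFactorTrace
  have hτ : IsFaithfulTracialState τ := h.toIsFaithfulTracialState
  have hfix := hτ.almostFixedAreScalar_withInner σ hσ
  obtain ⟨J, κ, hκ, hJ⟩ := h.exists_spectral_gap hfix (hτ.controlsCommutators_withInner σ)
  refine ⟨J.toLeft, J.toRight, κ, hκ, fun x => ?_⟩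
  have h1 := hJ x
  rw [← Finset.toLeft_disjSum_toRight (u := J), Finset.sum_disjSum] at h1
  simp only [hτ.l2Norm_withInner_inl] at h1
  exact h1

theorem theorem3p1 {H : Type u} [NormedAddCommGroup H] [InnerProductSpace ℂ H] [CompleteSpace H]
    (N : VonNeumannAlgebra H) (τ : N.toStarSubalgebra →ₗ[ℂ] ℂ) (hN : IsIIOneFactor N τ)
    {Γ : Type v} [Group Γ] (σ : Γ →* (N.toStarSubalgebra ≃⋆ₐ[ℂ] N.toStarSubalgebra))
    (hσ : ∀ (I : Type (max u v)) [Preorder I] [IsDirectedOrder I] [Nonempty I]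
      (x : I → N.toStarSubalgebra),
      (∃ C : ℝ, ∀ i, ‖x i‖ ≤ C) →
      (∀ a : N.toStarSubalgebra, Tendsto (fun i => twoNorm τ (x i * a - a * x i)) atTop (𝓝 0)) →
      (∀ g : Γ, Tendsto (fun i => twoNorm τ (σ g (x i) - x i)) atTop (𝓝 0)) →
      Tendsto (fun i => twoNorm τ (x i - τ (x i) • 1)) atTop (𝓝 0)) :
    ∃ (S : Finset (unitary N.toStarSubalgebra)) (K : Finset Γ) (κ : ℝ), 0 < κ ∧
      ∀ x : N.toStarSubalgebra,
        twoNorm τ (x - τ x • 1) ≤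
          κ * (∑ u ∈ S, twoNorm τ ((u : N.toStarSubalgebra) * x - x * u) +
            ∑ g ∈ K, twoNorm τ (σ g x - x)) := by
  exact IsIIOneFactor.exists_spectral_gap N τ hN σ hσ
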